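/- Let $M$ be a smooth $n$-dimensional manifold (without boundary) and let $\boldsymbol\eta=(\eta^1,\dots,\eta^k)\in\Omega^1(M,\mathbb{R}^k)$ be a $k$-contact form on $M$, that is, a smooth $\mathbb{R}^k$-valued one-form such that (1) $\ker\boldsymbol\eta=\bigcap_\alpha\ker\eta^\alpha\subset TM$ is a non-zero distribution of constant corank $k$; (2) $\ker d\boldsymbol\eta=\{v\in TM:\iota_v d\eta^\alpha=0\ \text{for all }\alpha\}$ is a distribution of constant rank $k$; (3) $\ker\boldsymbol\eta\cap\ker d\boldsymbol\eta=0$. Let $R_1,\dots,R_k$ be the Reeb vector fields of $(M,\boldsymbol\eta)$, i.e. the unique vector fields with $\iota_{R_\alpha}\eta^\beta=\delta_\alpha^\beta$ and $\iota_{R_\alpha}d\eta^\beta=0$ for all $\alpha,\beta=1,\dots,k$. Then around every point $p\in M$ there are smooth local coordinates $\{s^\alpha,x^I\}$, $\alpha=1,\dots,k$, $I=1,\dots,n-k$, defined on an open neighbourhood $U$ of $p$, and functions $f^\alpha_I$ of the variables $x=(x^1,\dots,x^{n-k})$ alone, smooth on the image of $U$ under $(x^1,\dots,x^{n-k})$,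 such that on $U$ $$R_\alpha=\frac{\partial}{\partial s^\alpha},\qquad \eta^\alpha=ds^\alpha-\sum_{I=1}^{n-k}f^\alpha_I(x)\,dx^I,\qquad \alpha=1,\dots,k.$$ -/

import Mathlib

open scoped Manifold ContDiff Topology

noncomputable section

namespace KContact

/-- An `ℝ^k`-valued field of covectors on an `n`-dimensional manifold `M` (smoothness is the
separate predicate `IsSmoothForm`). -/
abbrev Form (n k : ℕ) (M : Type*) [TopologicalSpace M]
    [ChartedSpace (EuclideanSpace ℝ (Fin n)) M] : Type _ :=
  Π x : M, TangentSpace (𝓡 n) x →L[ℝ] (Fin k → ℝ)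

section

variable {n k : ℕ} {M : Type*} [TopologicalSpace M] [ChartedSpace (EuclideanSpace ℝ (Fin n)) M]
  [IsManifold (𝓡 n) ∞ M]

/-- Smoothness of an `ℝ^k`-valued one-form, as a section of the bundle `Hom(TM, ℝ^k)`. -/
def IsSmoothForm (η : Form n k M) : Prop :=
  ContMDiff (𝓡 n) ((𝓡 n).prod 𝓘(ℝ, EuclideanSpace ℝ (Fin n) →L[ℝ] (Fin k → ℝ))) ∞
    (fun x ↦ Bundle.TotalSpace.mk' (EuclideanSpace ℝ (Fin n) →L[ℝ] (Fin k → ℝ))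
      (E := fun x ↦ TangentSpace (𝓡 n) x →L[ℝ] Bundle.Trivial M (Fin k → ℝ) x) x (η x))

end

section

variable {n k : ℕ} {M : Type*} [TopologicalSpace M] [ChartedSpace (EuclideanSpace ℝ (Fin n)) M]

/-- The coordinate expression of `η` in the preferred chart `φ` at `x₀`: the pullback
`(φ⁻¹)^* η`, as a one-form on the model space. It is meaningful on the target of `φ`. -/
def Form.inChart (η : Form n k M) (x₀ : M) (y : EuclideanSpace ℝ (Fin n)) :
    EuclideanSpace ℝ (Fin n) [⋀^Fin 1]→L[ℝ] (Fin k → ℝ) :=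
  ContinuousAlternatingMap.ofSubsingleton ℝ (EuclideanSpace ℝ (Fin n)) (Fin k → ℝ) (0 : Fin 1)
    ((η ((extChartAt (𝓡 n) x₀).symm y)).comp
      (mfderiv 𝓘(ℝ, EuclideanSpace ℝ (Fin n)) (𝓡 n) (extChartAt (𝓡 n) x₀).symm y))

/-- The exterior derivative `dη` at `x`: take the exterior derivative of the coordinate expression
of `η` in the chart `φ` at `x`, and pull the result back to `T_x M` along `dφ_x`. -/
def Form.d (η : Form n k M) (x : M) : TangentSpace (𝓡 n) x [⋀^Fin 2]→L[ℝ] (Fin k → ℝ) :=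
  (extDeriv (η.inChart x) (extChartAt (𝓡 n) x x)).compContinuousLinearMap
    (mfderiv (𝓡 n) 𝓘(ℝ, EuclideanSpace ℝ (Fin n)) (extChartAt (𝓡 n) x) x)

/-- The fibre at `x` of the distribution `ker η`. -/
def Form.kerAt (η : Form n k M) (x : M) : Submodule ℝ (TangentSpace (𝓡 n) x) :=
  LinearMap.ker (η x).toLinearMap

/-- The fibre at `x` of the distribution `ker dη`, i.e. all `v ∈ T_x M` with `ι_v dη = 0`. -/
def Form.kerDAt (η : Form n k M) (x : M) : Submodule ℝ (TangentSpace (𝓡 n) x) where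
  carrier := {v | ∀ w : TangentSpace (𝓡 n) x, η.d x ![v, w] = 0}
  zero_mem' w := (η.d x).map_coord_zero (i := 0) rfl
  add_mem' {a b} ha hb w := by
    have h := (η.d x).map_update_add ![a, w] 0 a b
    have e : ∀ c : TangentSpace (𝓡 n) x, Function.update ![a, w] 0 c = ![c, w] := by
      intro c; ext i : 1; fin_cases i <;> rfl
    rw [e, e, e] at h
    rw [h, ha w, hb w, add_zero]
  smul_mem' r a ha w := by
    have h := (η.d x).map_update_smul ![a, w] 0 r a
    have e : ∀ c : TangentSpace (𝓡 n) x, Function.update ![a, w] 0 c = ![c, w] := by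
      intro c; ext i : 1; fin_cases i <;> rfl
    rw [e, e] at h
    rw [h, ha w, smul_zero]

end

section

variable {n k : ℕ} {M : Type*} [TopologicalSpace M] [ChartedSpace (EuclideanSpace ℝ (Fin n)) M]
  [IsManifold (𝓡 n) ∞ M]

/-- A `k`-contact form: a smooth `ℝ^k`-valued one-form `η` such that `ker η` is a non-zero
distribution of constant corank `k`, `ker dη` is a distribution of constant rank `k`, and
`ker η ∩ ker dη = 0`. -/
structure IsKContactForm (η : Form n k M) : Prop where
  smooth : IsSmoothForm η
  corank_ker : ∀ x, Module.finrank ℝ (TangentSpace (𝓡 n) x ⧸ η.kerAt x) = k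
  ker_ne_bot : ∀ x, η.kerAt x ≠ ⊥
  rank_kerD : ∀ x, Module.finrank ℝ (η.kerDAt x) = k
  ker_inf_kerD : ∀ x, η.kerAt x ⊓ η.kerDAt x = ⊥

/-- The defining equations of the `α`-th Reeb vector at `x`, namely `ι_v η^β = δ_α^β` and
`ι_v dη^β = 0` for all `β`, have exactly one solution. -/
theorem IsKContactForm.existsUnique_reeb {η : Form n k M} (hη : IsKContactForm η) (α : Fin k)
    (x : M) :
    ∃! v : TangentSpace (𝓡 n) x,
      (∀ β, η x v β = if α = β then 1 else 0) ∧ (∀ w β, η.d x ![v, w] β = 0) := by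
  have : FiniteDimensional ℝ (TangentSpace (𝓡 n) x) :=
    inferInstanceAs (FiniteDimensional ℝ (EuclideanSpace ℝ (Fin n)))
  let L : η.kerDAt x →ₗ[ℝ] (Fin k → ℝ) := (η x).toLinearMap.comp (η.kerDAt x).subtype
  have hinj : Function.Injective L := by
    rw [← LinearMap.ker_eq_bot, LinearMap.ker_eq_bot']
    rintro ⟨v, hv⟩ h
    have : v ∈ η.kerAt x ⊓ η.kerDAt x := ⟨h, hv⟩
    rw [hη.ker_inf_kerD x, Submodule.mem_bot] at this
    exact Subtype.ext this
  have hsurj : Function.Surjective L :=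
    (LinearMap.injective_iff_surjective_of_finrank_eq_finrank
      (by rw [hη.rank_kerD x, Module.finrank_fin_fun])).1 hinj
  obtain ⟨⟨v, hv⟩, hvα⟩ := hsurj (fun β ↦ if α = β then 1 else 0)
  refine ⟨v, ⟨fun β ↦ congrFun hvα β, fun w β ↦ congrFun (hv w) β⟩, ?_⟩
  rintro v' ⟨h1, h2⟩
  have hv' : v' ∈ η.kerDAt x := fun w ↦ funext (h2 w)
  have : (⟨v', hv'⟩ : η.kerDAt x) = ⟨v, hv⟩ := hinj ((funext h1 : L ⟨v', hv'⟩ = _).trans hvα.symm)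
  exact congrArg Subtype.val this

/-- The `α`-th Reeb vector field `R_α` of a `k`-contact form: the unique vector field with
`ι_{R_α} η^β = δ_α^β` and `ι_{R_α} dη^β = 0` for all `β`. -/
def IsKContactForm.reeb {η : Form n k M} (hη : IsKContactForm η) (α : Fin k) (x : M) :
    TangentSpace (𝓡 n) x :=
  (hη.existsUnique_reeb α x).choose

theorem IsKContactForm.reeb_spec {η : Form n k M} (hη : IsKContactForm η) (α : Fin k) (x : M) :
    (∀ β, η x (hη.reeb α x) β = if α = β then 1 else 0) ∧
      (∀ w β, η.d x ![hη.reeb α x, w] β = 0) :=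
  (hη.existsUnique_reeb α x).choose_spec.1

end

section

variable {n : ℕ} {ι : Type*} [Fintype ι] {M : Type*} [TopologicalSpace M]
  [ChartedSpace (EuclideanSpace ℝ (Fin n)) M]

/-- A system of smooth local coordinates indexed by `ι`: a homeomorphism from an open subset of `M`
onto an open subset of `ℝ^ι` that is smooth in both directions. The coordinate functions are
`fun q ↦ φ q i` for `i : ι`. -/
structure IsLocalCoordinates (φ : OpenPartialHomeomorph M (ι → ℝ)) : Prop where
  contMDiffOn : ContMDiffOn (𝓡 n) 𝓘(ℝ, ι → ℝ) ∞ φ φ.source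
  contMDiffOn_symm : ContMDiffOn 𝓘(ℝ, ι → ℝ) (𝓡 n) ∞ φ.symm φ.target

/-- The coordinate vector field `∂/∂y^i` of the local coordinates `φ`: the pullback along `φ` of
the `i`-th constant basis vector field of `ℝ^ι`. It is meaningful on `φ.source`. -/
def coordVectorField [DecidableEq ι] (φ : OpenPartialHomeomorph M (ι → ℝ)) (i : ι) (q : M) :
    TangentSpace (𝓡 n) q :=
  VectorField.mpullback (𝓡 n) 𝓘(ℝ, ι → ℝ) φ
    (fun _ ↦ (Pi.single i (1 : ℝ) : ι → ℝ)) q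

/-- The coordinate one-form `dy^i` of the local coordinates `φ`: the differential of the `i`-th
coordinate function. It is meaningful on `φ.source`. -/
def coordOneForm (φ : OpenPartialHomeomorph M (ι → ℝ)) (i : ι) (q : M) :
    TangentSpace (𝓡 n) q →L[ℝ] ℝ :=
  mvfderiv (𝓡 n) (fun q' ↦ φ q' i) q

end

end KContact

end

-- By condition (3) a tangent vector v is determined by η(v) and ι_v dη. The Reeb fields thus solve
-- an injective linear system with smooth coefficients, so they are smooth
-- (`contDiffOn_of_injective_clm_apply_eq`). Differentiating their defining equations shows that
-- [R_α, R_β] is annihilated by η and annihilates dη; hence it vanishes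
-- (`fderiv_apply_comm_of_reeb`).
--
-- Commuting fields have a smooth joint flow exp(∑ s^α R_α) whose s^α-derivative is R_α
-- (`exists_contDiffOn_flow_of_commute`). Applied to a slice through p tangent to ker η at p, it
-- gives coordinates (s, x) with R_α = ∂/∂s^α. There the ds-coefficients of η are those of the
-- identity. Cartan's formula gives L_{R_α} η^β = d(δ_α^β) + ι_{R_α} dη^β = 0, so the
-- dx-coefficients do not depend on s (`exists_coordinates_of_reeb`).
--
-- The flow is obtained from the integral equation γ = x + ∑ t_j ∫ R_j(γ) in C([0,1], E), solved by
-- the inverse function theorem; smoothness in (t, x) comes at once because superposition operators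
-- are smooth. If the fields commute, u ↦ u R_i(γ(u)) solves the equation linearised in t_i, and
-- uniqueness for small t identifies it with ∂γ/∂t_i; evaluate at u = 1.
--
-- All this takes place in one chart at p. Since `Form.d` uses a different chart at each point,
-- `Form.d_apply` is needed to compute dη throughout that chart.

universe u

/-! ### Superposition operators on spaces of continuous functions. -/

namespace ContinuousMap

section Nemytskii

variable {X : Type*} [TopologicalSpace X] [CompactSpace X]
  {E G : Type*} [NormedAddCommGroup E] [NormedSpace ℝ E] [NormedAddCommGroup G] [NormedSpace ℝ G]

/-- Pointwise application of a continuous family of continuous linear maps, as a continuous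
bilinear map between spaces of continuous functions on a compact space. -/
noncomputable def applyCLM (X E G : Type*) [TopologicalSpace X] [CompactSpace X]
    [NormedAddCommGroup E] [NormedSpace ℝ E] [NormedAddCommGroup G] [NormedSpace ℝ G] :
    C(X, E →L[ℝ] G) →L[ℝ] C(X, E) →L[ℝ] C(X, G) :=
  LinearMap.mkContinuous₂
    (LinearMap.mk₂ ℝ (fun (A : C(X, E →L[ℝ] G)) (h : C(X, E)) ↦
        (⟨fun u ↦ A u (h u), by fun_prop⟩ : C(X, G)))
      (fun _ _ _ ↦ by ext; simp) (fun _ _ _ ↦ by ext; simp) (fun _ _ _ ↦ by ext; simp)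
      (fun _ _ _ ↦ by ext; simp)) 1 (fun A h ↦ by
        rw [one_mul, ContinuousMap.norm_le _ (by positivity)]
        intro u
        exact (ContinuousLinearMap.le_opNorm _ _).trans
          (mul_le_mul (A.norm_coe_le_norm u) (h.norm_coe_le_norm u)
            (norm_nonneg _) (norm_nonneg A)))

@[simp]
theorem applyCLM_apply (A : C(X, E →L[ℝ] G)) (h : C(X, E)) (u : X) :
    applyCLM X E G A h u = A u (h u) := rfl

/-- The superposition operator `γ ↦ f ∘ γ` of a `C¹` map is differentiable. -/
theorem hasFDerivAt_comp_left (f : C(E, G)) (f' : C(E, E →L[ℝ] G))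
    (hf : ∀ y, HasFDerivAt f (f' y) y) (γ : C(X, E)) :
    HasFDerivAt (fun γ : C(X, E) ↦ f.comp γ) (applyCLM X E G (f'.comp γ)) γ := by
  rw [hasFDerivAt_iff_isLittleO_nhds_zero, Asymptotics.isLittleO_iff]
  intro ε hε
  have hc : Continuous fun γ : C(X, E) ↦ f'.comp γ := ContinuousMap.continuous_postcomp f'
  obtain ⟨δ, hδ, hball⟩ :=
    (Metric.continuousAt_iff (α := C(X, E)) (β := C(X, E →L[ℝ] G))).1
      (hc.continuousAt (x := γ)) ε hε
  filter_upwards [Metric.ball_mem_nhds (0 : C(X, E)) hδ] with h hh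
  rw [ContinuousMap.norm_le _ (by positivity)]
  intro u
  have hhu : ‖h u‖ < δ := (h.norm_coe_le_norm u).trans_lt (by simpa using hh)
  have key := (convex_ball (γ u) δ).norm_image_sub_le_of_norm_fderiv_le' (f := f) (𝕜 := ℝ)
    (C := ε) (φ := f' (γ u)) (x := γ u) (y := γ u + h u) (fun y _ ↦ (hf y).differentiableAt)
    (fun y hy ↦ by
      rw [(hf y).fderiv]
      -- Translating γ by the constant y - γ u gives a curve within δ of γ that passes through y at
      -- u, so continuity of γ ↦ f' ∘ γ bounds f' y - f' (γ u) uniformly in u.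
      have hd : dist (γ + ContinuousMap.const X (y - γ u)) γ < δ := by
        rw [dist_eq_norm, add_sub_cancel_left]
        refine (ContinuousMap.norm_lt_iff _ hδ).2 fun v ↦ ?_
        simpa [dist_eq_norm] using hy
      have := (ContinuousMap.dist_apply_le_dist u).trans (hball hd).le
      simpa [dist_eq_norm] using this)
    (by simpa using hδ) (by simpa using hhu)
  simp only [add_sub_cancel_left] at key
  exact key.trans (mul_le_mul_of_nonneg_left (h.norm_coe_le_norm u) hε.le)

end Nemytskii

/-- The superposition operator `γ ↦ f ∘ γ` of a smooth map is smooth. -/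
theorem contDiff_comp_left {X : Type*} [TopologicalSpace X] [CompactSpace X] {E G : Type u}
    [NormedAddCommGroup E] [NormedSpace ℝ E] [NormedAddCommGroup G] [NormedSpace ℝ G]
    (f : C(E, G)) (hf : ContDiff ℝ ∞ f) :
    ContDiff ℝ ∞ (fun γ : C(X, E) ↦ f.comp γ) := by
  refine contDiff_infty.2 fun m ↦ ?_
  have hfm : ContDiff ℝ m f := hf.of_le (by exact_mod_cast le_top)
  clear hf
  -- The derivative is governed by the superposition operator of `fderiv ℝ f`, whose values lie in
  -- `E →L[ℝ] G`. The induction therefore varies `G`, which is why `E` and `G` share a universe.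
  induction m generalizing G with
  | zero =>
    exact contDiff_zero.2 (ContinuousMap.continuous_postcomp f)
  | succ m ih =>
    have hf1 : ContDiff ℝ (m + 1) f := by exact_mod_cast hfm
    let f' : C(E, E →L[ℝ] G) := ⟨fderiv ℝ f, hf1.continuous_fderiv (by simp)⟩
    have hd : ∀ y, HasFDerivAt f (f' y) y := fun y ↦ (hf1.differentiable (by simp) y).hasFDerivAt
    have : ContDiff ℝ (m + 1 : ℕ) (fun γ : C(X, E) ↦ f.comp γ) := by
      push_cast
      refine contDiff_succ_iff_hasFDerivAt.2
        ⟨_, ?_, fun γ ↦ ContinuousMap.hasFDerivAt_comp_left f f' hd γ⟩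
      exact (ContinuousMap.applyCLM X E G).contDiff.comp
        (ih f' (hf1.fderiv_right (m := m) le_rfl))
    exact this

end ContinuousMap

/-! ### Smooth inverse function theorem. -/

/-- Inverse function theorem for smooth maps, with smoothness of the inverse on its whole
domain. -/
theorem ContDiffOn.exists_openPartialHomeomorph {E F : Type*} [NormedAddCommGroup E]
    [NormedSpace ℝ E] [CompleteSpace E] [NormedAddCommGroup F] [NormedSpace ℝ F]
    {f : E → F} {U : Set E} {a : E} {f' : E ≃L[ℝ] F} (hf : ContDiffOn ℝ ∞ f U)
    (hU : IsOpen U) (ha : a ∈ U) (hf' : HasFDerivAt f (f' : E →L[ℝ] F) a) :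
    ∃ e : OpenPartialHomeomorph E F, a ∈ e.source ∧ e.source ⊆ U ∧ (⇑e = f) ∧
      ContDiffOn ℝ ∞ e.symm e.target := by
  have hfa : ContDiffAt ℝ ∞ f a := hf.contDiffAt (hU.mem_nhds ha)
  have hs : HasStrictFDerivAt f (f' : E →L[ℝ] F) a := hfa.hasStrictFDerivAt' hf' (by simp)
  let e₀ := hs.toOpenPartialHomeomorph f
  -- Restricting to points with invertible derivative, an open condition, makes the inverse smooth
  -- at every point of the target and not only at the image of `a`.
  let S : Set E := U ∩ {x | fderiv ℝ f x ∈ Set.range ContinuousLinearEquiv.toContinuousLinearMap}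
  have hS : IsOpen S :=
    (hf.continuousOn_fderiv_of_isOpen hU (by simp)).isOpen_inter_preimage hU
      ContinuousLinearEquiv.isOpen
  let e := e₀.restrOpen S hS
  have hsrc : e.source = e₀.source ∩ S := e₀.restrOpen_source S hS
  have hcoe : ⇑e = f := rfl
  refine ⟨e, ?_, ?_, hcoe, ?_⟩
  · rw [hsrc]
    exact ⟨hs.mem_toOpenPartialHomeomorph_source, ha, f', hf'.fderiv.symm⟩
  · rw [hsrc]
    exact fun x hx ↦ hx.2.1
  · intro y hy
    have hx : e.symm y ∈ e.source := e.map_target hy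
    rw [hsrc] at hx
    obtain ⟨hxU, g, hg⟩ := hx.2
    have hfx : ContDiffAt ℝ ∞ f (e.symm y) := hf.contDiffAt (hU.mem_nhds hxU)
    refine (e.contDiffAt_symm hy (f₀' := g) ?_ (by rwa [hcoe])).contDiffWithinAt
    rw [hcoe, hg]
    exact (hfx.differentiableAt (by simp)).hasFDerivAt

/-! ### Integration operator and the equation of variations. -/

open unitInterval in
/-- The operator `g ↦ (u ↦ ∫₀ᵘ g)` on continuous functions on the unit interval. -/
noncomputable def ContinuousMap.primitiveCLM (E : Type*) [NormedAddCommGroup E] [NormedSpace ℝ E] :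
    C(I, E) →L[ℝ] C(I, E) :=
  have hint (g : C(I, E)) (a b : ℝ) : IntervalIntegrable
      (fun s ↦ g (Set.projIcc 0 1 zero_le_one s)) MeasureTheory.volume a b :=
    (g.continuous.comp continuous_projIcc).intervalIntegrable a b
  LinearMap.mkContinuous
    { toFun := fun g ↦ ⟨fun u ↦ ∫ s in (0 : ℝ)..u, g (Set.projIcc 0 1 zero_le_one s),
        (intervalIntegral.continuous_primitive (hint g) 0).comp continuous_subtype_val⟩
      map_add' := fun g h ↦ by
        ext u
        exact intervalIntegral.integral_add (hint g 0 u) (hint h 0 u)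
      map_smul' := fun c g ↦ by
        ext u
        exact intervalIntegral.integral_smul c _ }
    1 (fun g ↦ by
      rw [one_mul, ContinuousMap.norm_le _ (norm_nonneg g)]
      intro u
      refine (intervalIntegral.norm_integral_le_of_norm_le_const
        (fun s _ ↦ g.norm_coe_le_norm _)).trans ?_
      have : |(u : ℝ) - 0| ≤ 1 := by
        rw [sub_zero, abs_of_nonneg u.2.1]; exact u.2.2
      exact mul_le_of_le_one_right (norm_nonneg g) this)

section

open unitInterval ContinuousMap

variable {E : Type*} [NormedAddCommGroup E] [NormedSpace ℝ E]

theorem ContinuousMap.primitiveCLM_apply (g : C(I, E)) (u : I) :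
    primitiveCLM E g u = ∫ s in (0 : ℝ)..u, g (Set.projIcc 0 1 zero_le_one s) := rfl

theorem ContinuousMap.norm_primitiveCLM_le (g : C(I, E)) : ‖primitiveCLM E g‖ ≤ ‖g‖ :=
  ((primitiveCLM E).le_of_opNorm_le
    (by unfold primitiveCLM; exact LinearMap.mkContinuous_norm_le _ zero_le_one _) g).trans_eq
    (one_mul _)

/-- If `γ` is an integral curve of `∑ j, t j • R j` and the fields `R j` commute along `γ`, then
`u ↦ u • R i (γ u)` solves the equation of variations of `γ` with respect to `t i`. -/
theorem smul_comp_eq_primitive_of_commute [CompleteSpace E] {ι : Type*} [Fintype ι]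
    {R : ι → C(E, E)} {R' : ι → C(E, E →L[ℝ] E)} (hR : ∀ i y, HasFDerivAt (R i) (R' i y) y)
    {γ : C(I, E)} {x : E} {t : ι → ℝ}
    (hγ : γ = .const I x + ∑ j, t j • primitiveCLM E ((R j).comp γ))
    (hcomm : ∀ u i j, R' j (γ u) (R i (γ u)) = R' i (γ u) (R j (γ u))) (i : ι) {h : C(I, E)}
    (hh : ∀ u : I, h u = (u : ℝ) • R i (γ u)) :
    h = primitiveCLM E ((R i).comp γ) +
      ∑ j, t j • primitiveCLM E (applyCLM I E E ((R' j).comp γ) h) := by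
  set pr : ℝ → I := Set.projIcc 0 1 zero_le_one with hpr
  set g : C(I, E) := ∑ j, t j • (R j).comp γ with hg
  have hγ' : γ = .const I x + primitiveCLM E g := by
    conv_lhs => rw [hγ]
    simp [hg, map_sum, map_smul]
  -- An extension of γ to a C¹ curve on ℝ, so that derivatives at the endpoints of [0,1] are
  -- two-sided.
  let γ' : ℝ → E := fun s ↦ x + ∫ r in (0 : ℝ)..s, g (pr r)
  have hγγ' (u : I) : γ' u = γ u := by rw [hγ']; rfl
  have hgc : Continuous fun r ↦ g (pr r) := g.continuous.comp continuous_projIcc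
  have hγ'd (s : ℝ) : HasDerivAt γ' (g (pr s)) s :=
    (intervalIntegral.integral_hasDerivAt_right (hgc.intervalIntegrable 0 s)
      hgc.aestronglyMeasurable.stronglyMeasurableAtFilter hgc.continuousAt).const_add x
  have hkd (s : ℝ) : HasDerivAt (fun s ↦ s • R i (γ' s))
      (s • R' i (γ' s) (g (pr s)) + (1 : ℝ) • R i (γ' s)) s :=
    (hasDerivAt_id s).smul ((hR i (γ' s)).comp_hasDerivAt s (hγ'd s))
  rw [show primitiveCLM E ((R i).comp γ) +
      ∑ j, t j • primitiveCLM E (applyCLM I E E ((R' j).comp γ) h) =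
      primitiveCLM E ((R i).comp γ + ∑ j, t j • applyCLM I E E ((R' j).comp γ) h) by
    simp [map_sum, map_smul]]
  ext u
  rw [primitiveCLM_apply, hh]
  have hγ'c : Continuous γ' := continuous_iff_continuousAt.2 fun s ↦ (hγ'd s).continuousAt
  have hcont : Continuous fun s : ℝ ↦ s • R' i (γ' s) (g (pr s)) + (1 : ℝ) • R i (γ' s) :=
    (continuous_id.smul (((R' i).continuous.comp hγ'c).clm_apply hgc)).add
      (((R i).continuous.comp hγ'c).const_smul _)
  have hFTC := intervalIntegral.integral_eq_sub_of_hasDerivAt (a := 0) (b := (u : ℝ))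
    (fun s _ ↦ hkd s) (hcont.intervalIntegrable _ _)
  rw [hγγ', zero_smul, sub_zero] at hFTC
  rw [← hFTC]
  refine intervalIntegral.integral_congr fun s hs ↦ ?_
  rw [Set.uIcc_of_le u.2.1] at hs
  have hsI : s ∈ I := ⟨hs.1, hs.2.trans u.2.2⟩
  have hprs : pr s = ⟨s, hsI⟩ := Set.projIcc_of_mem zero_le_one hsI
  have hγs : γ' s = γ ⟨s, hsI⟩ := hγγ' ⟨s, hsI⟩
  have hprs' : Set.projIcc 0 1 zero_le_one s = (⟨s, hsI⟩ : I) := hprs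
  -- Here `hcomm` replaces R_i'(γ) R_j(γ) by R_j'(γ) R_i(γ), turning the derivative of s R_i(γ(s))
  -- into the integrand of the equation of variations.
  simp only [hprs, hprs', hγs, hg, ContinuousMap.add_apply, ContinuousMap.sum_apply,
    ContinuousMap.smul_apply, ContinuousMap.comp_apply, applyCLM_apply, hh, map_sum, map_smul,
    hcomm _ i, one_smul, Finset.smul_sum]
  rw [add_comm]
  congr 1
  refine Finset.sum_congr rfl fun j _ ↦ ?_
  rw [smul_comm]

end

/-! ### Joint flow of commuting vector fields. -/

section

open unitInterval ContinuousMap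

/-- Commuting smooth vector fields have, near each point, a smooth joint flow
`Φ (t, x) = exp (∑ i, t i • R i) x`, whose derivative with respect to `t i` is `R i`. -/
theorem exists_contDiffOn_flow_of_commute {ι : Type*} [Fintype ι] [DecidableEq ι]
    {E : Type u} [NormedAddCommGroup E] [NormedSpace ℝ E] [CompleteSpace E]
    {R : ι → E → E} (hR : ∀ i, ContDiff ℝ ∞ (R i)) {C : ℝ} (hC : ∀ i y, ‖fderiv ℝ (R i) y‖ ≤ C)
    {x₀ : E} {V : Set E} (hV : V ∈ 𝓝 x₀)
    (hcomm : ∀ y ∈ V, ∀ i j, fderiv ℝ (R j) y (R i y) = fderiv ℝ (R i) y (R j y)) :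
    ∃ (U : Set ((ι → ℝ) × E)) (Φ : (ι → ℝ) × E → E), IsOpen U ∧ (0, x₀) ∈ U ∧
      ContDiffOn ℝ ∞ Φ U ∧ (∀ x, (0, x) ∈ U → Φ (0, x) = x) ∧
      ∀ p ∈ U, ∀ i, fderiv ℝ Φ p (Pi.single i 1, 0) = R i (Φ p) := by
  let N : ι → C(E, E) := fun i ↦ ⟨R i, (hR i).continuous⟩
  let N' : ι → C(E, E →L[ℝ] E) := fun i ↦ ⟨fderiv ℝ (R i), (hR i).continuous_fderiv (by simp)⟩
  have hN (i : ι) (y : E) : HasFDerivAt (N i) (N' i y) y :=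
    ((hR i).differentiable (by simp) y).hasFDerivAt
  obtain ⟨K, hK⟩ : ∃ K : E →L[ℝ] C(I, E), ∀ x, K x = .const I x :=
    ⟨ContinuousLinearMap.const ℝ I, fun _ ↦ rfl⟩
  obtain ⟨ev, hev⟩ : ∃ ev : C(I, E) →L[ℝ] E, ∀ γ, ev γ = γ 1 :=
    ⟨ContinuousMap.evalCLM ℝ (1 : I), fun _ ↦ rfl⟩
  let Q : C(I, E) →L[ℝ] C(I, E) := primitiveCLM E
  -- Zeros of `G` are the curves γ with γ(0) = x and γ' = ∑ t_j R_j(γ), in integrated form.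
  let G : ((ι → ℝ) × E) × C(I, E) → C(I, E) := fun q ↦
    q.2 - (K q.1.2 + ∑ j, q.1.1 j • Q ((N j).comp q.2))
  have hG : ContDiff ℝ ∞ G := by
    refine contDiff_snd.sub (.add ?_ ?_)
    · exact K.contDiff.comp (contDiff_snd.comp contDiff_fst)
    · refine ContDiff.sum fun j _ ↦ ContDiff.fun_smul ?_ ?_
      · exact (contDiff_apply ℝ ℝ j).comp (contDiff_fst.comp contDiff_fst)
      · exact Q.contDiff.comp ((contDiff_comp_left (N j) (hR j)).comp contDiff_snd)
  have hGd (p v : (ι → ℝ) × E) (γ h : C(I, E)) : fderiv ℝ G (p, γ) (v, h) =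
      h - (K v.2 + ∑ j, (p.1 j • Q (applyCLM I E E ((N' j).comp γ) h) +
        v.1 j • Q ((N j).comp γ))) := by
    have hNd (j : ι) : HasFDerivAt (fun q : ((ι → ℝ) × E) × C(I, E) ↦ (N j).comp q.2) _ (p, γ) :=
      HasFDerivAt.comp (g := fun γ : C(I, E) ↦ (N j).comp γ) (p, γ)
        (hasFDerivAt_comp_left (N j) (N' j) (hN j) γ) (hasFDerivAt_snd (𝕜 := ℝ) (p := (p, γ)))
    have hQd (j : ι) :
        HasFDerivAt (fun q : ((ι → ℝ) × E) × C(I, E) ↦ Q ((N j).comp q.2)) _ (p, γ) :=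
      HasFDerivAt.comp (p, γ) Q.hasFDerivAt (hNd j)
    have hS (j : ι) : HasFDerivAt (fun q : ((ι → ℝ) × E) × C(I, E) ↦ q.1.1 j • Q ((N j).comp q.2))
        _ (p, γ) :=
      HasFDerivAt.fun_smul
        (ContinuousLinearMap.proj j ∘L (ContinuousLinearMap.fst ℝ (ι → ℝ) E ∘L
              ContinuousLinearMap.fst ℝ ((ι → ℝ) × E) C(I, E))).hasFDerivAt
        (hQd j)
    have hKd : HasFDerivAt (fun q : ((ι → ℝ) × E) × C(I, E) ↦ K q.1.2) _ (p, γ) :=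
      (K ∘L (ContinuousLinearMap.snd ℝ (ι → ℝ) E ∘L
              ContinuousLinearMap.fst ℝ ((ι → ℝ) × E) C(I, E))).hasFDerivAt
    have := (hasFDerivAt_snd (𝕜 := ℝ) (p := (p, γ))).sub
      (hKd.add (HasFDerivAt.fun_sum (u := Finset.univ) fun j _ ↦ hS j))
    rw [show fderiv ℝ G (p, γ) = _ from this.fderiv]
    simp
  let H : ((ι → ℝ) × E) × C(I, E) → ((ι → ℝ) × E) × C(I, E) := fun q ↦ (q.1, G q)
  have hH : ContDiff ℝ ∞ H := contDiff_fst.prodMk hG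
  let q₀ : ((ι → ℝ) × E) × C(I, E) := ((0, x₀), K x₀)
  -- At t = 0 the partial derivative of `G` in γ is the identity, so the derivative of `H` is
  -- unipotent triangular.
  let f' : (((ι → ℝ) × E) × C(I, E)) ≃L[ℝ] (((ι → ℝ) × E) × C(I, E)) :=
    ContinuousLinearEquiv.skewProd (.refl ℝ _) (.refl ℝ _)
      (fderiv ℝ G q₀ ∘L ContinuousLinearMap.inl ℝ _ _)
  have hf' : HasFDerivAt H (f' : _ →L[ℝ] _) q₀ := by
    refine (hasFDerivAt_fst.prodMk (hG.differentiable (by simp) q₀).hasFDerivAt).congr_fderiv ?_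
    refine ContinuousLinearMap.ext fun v ↦ ?_
    obtain ⟨v, h⟩ := v
    simp only [f', q₀, ContinuousLinearMap.prod_apply, hGd, ContinuousLinearEquiv.coe_coe,
      ContinuousLinearEquiv.skewProd_apply, ContinuousLinearMap.comp_apply,
      ContinuousLinearMap.inl_apply]
    simp [sub_eq_add_neg]
  obtain ⟨e, hae, -, hecoe, hesymm⟩ :=
    hH.contDiffOn.exists_openPartialHomeomorph isOpen_univ (Set.mem_univ _) hf'
  have hHq₀ : H q₀ = ((0, x₀), 0) := by simp [H, G, q₀]
  have hGq₀ : ((0, x₀), 0) ∈ e.target := by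
    rw [← hHq₀, ← hecoe]; exact e.map_source hae
  let U₀ : Set ((ι → ℝ) × E) := {p | (p, 0) ∈ e.target}
  have hU₀ : IsOpen U₀ := e.open_target.preimage (Continuous.prodMk_left _)
  let Γ : (ι → ℝ) × E → C(I, E) := fun p ↦ (e.symm (p, 0)).2
  have hΓ : ContDiffOn ℝ ∞ Γ U₀ :=
    contDiff_snd.comp_contDiffOn (hesymm.comp (contDiff_prodMk_left _).contDiffOn fun _ hp ↦ hp)
  have hGΓ (p) (hp : p ∈ U₀) : G (p, Γ p) = 0 := by
    have := e.right_inv hp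
    rw [hecoe] at this
    have h1 : (e.symm (p, 0)).1 = p := congrArg Prod.fst this
    have h2 : G (e.symm (p, 0)) = 0 := congrArg Prod.snd this
    rwa [show e.symm (p, 0) = (p, Γ p) from Prod.ext h1 rfl] at h2
  have hΓ₀ : Γ (0, x₀) = K x₀ := by
    have := e.left_inv hae
    rw [hecoe, hHq₀] at this
    exact congrArg Prod.snd this
  obtain ⟨r, hr, hrV⟩ := Metric.mem_nhds_iff.1 hV
  -- Keeps the whole curve inside `V`, where the fields commute.
  let U₁ : Set ((ι → ℝ) × E) := U₀ ∩ {p | ‖Γ p - K x₀‖ < r}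
  have hU₁ : IsOpen U₁ :=
    (hΓ.continuousOn.sub continuousOn_const).norm.isOpen_inter_preimage hU₀ isOpen_Iio
  -- Makes the linearised integral operator a contraction, so the equation of variations has at most
  -- one solution.
  let U : Set ((ι → ℝ) × E) := U₁ ∩ {p | ∑ j, |p.1 j| * C < 1}
  have hU : IsOpen U := by
    refine hU₁.inter (isOpen_lt ?_ continuous_const)
    fun_prop
  refine ⟨U, fun p ↦ ev (Γ p), hU, ⟨⟨hGq₀, by simpa [hΓ₀] using hr⟩, by simp⟩,
    ev.contDiff.comp_contDiffOn
      (hΓ.mono fun p hp ↦ hp.1.1), fun x hx ↦ ?_, fun p hp i ↦ ?_⟩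
  · have : Γ (0, x) = K x := by simpa [G, sub_eq_zero] using hGΓ (0, x) hx.1.1
    simp [this, hK, hev]
  · set γ := Γ p with hγ
    obtain ⟨⟨hpU₀, hpr⟩, hpC⟩ := hp
    have hγV (u : I) : γ u ∈ V := hrV <| by
      rw [mem_ball_iff_norm]
      have := (ContinuousMap.norm_coe_le_norm (γ - K x₀) u).trans_lt hpr
      simpa [hK] using this
    have hΓd : HasFDerivAt Γ (fderiv ℝ Γ p) p :=
      ((hΓ.contDiffAt (hU₀.mem_nhds hpU₀)).differentiableAt (by simp)).hasFDerivAt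
    set J : C(I, E) := fderiv ℝ Γ p (Pi.single i 1, 0) with hJ
    let h : C(I, E) := ⟨fun u ↦ (u : ℝ) • N i (γ u), by fun_prop⟩
    have hγeq : γ = .const I p.2 + ∑ j, p.1 j • primitiveCLM E ((N j).comp γ) := by
      simpa [G, sub_eq_zero, hK] using hGΓ p hpU₀
    have hheq := smul_comp_eq_primitive_of_commute hN hγeq
      (fun u i j ↦ hcomm (γ u) (hγV u) i j) i (h := h) (fun _ ↦ rfl)
    -- Differentiate G(p, Γ p) = 0 in the direction t_i.
    have hJeq : J = Q ((N i).comp γ) + ∑ j, p.1 j • Q (applyCLM I E E ((N' j).comp γ) J) := by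
      have hcomp : HasFDerivAt (fun p ↦ G (p, Γ p)) _ p :=
        HasFDerivAt.comp p (hG.differentiable (by simp) (p, Γ p)).hasFDerivAt
          ((hasFDerivAt_id p).prodMk hΓd)
      have hzero : (fun p ↦ G (p, Γ p)) =ᶠ[𝓝 p] fun _ ↦ 0 :=
        Filter.eventually_of_mem (hU₀.mem_nhds hpU₀) hGΓ
      have := congrArg (fun L ↦ L (Pi.single i 1, 0))
        (hcomp.unique ((hasFDerivAt_const (0 : C(I, E)) p).congr_of_eventuallyEq hzero))
      simp only [ContinuousLinearMap.comp_apply, ContinuousLinearMap.prod_apply,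
        ContinuousLinearMap.id_apply, ← hJ, hGd, _root_.zero_apply, map_zero,
        zero_add, sub_eq_zero, Finset.sum_add_distrib] at this
      rw [add_comm]
      refine this.trans (congrArg₂ _ rfl ?_)
      simp [Pi.single_apply, ← hγ]
    have hδ : J - h = ∑ j, p.1 j • Q (applyCLM I E E ((N' j).comp γ) (J - h)) := by
      conv_lhs => rw [hJeq, hheq]
      simp [map_sub, smul_sub, Finset.sum_sub_distrib, Q]
    have hbound : ‖J - h‖ ≤ (∑ j, |p.1 j| * C) * ‖J - h‖ := by
      conv_lhs => rw [hδ]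
      rw [Finset.sum_mul]
      refine norm_sum_le_of_le _ fun j _ ↦ ?_
      rw [norm_smul, mul_assoc, Real.norm_eq_abs]
      refine mul_le_mul_of_nonneg_left ((norm_primitiveCLM_le _).trans ?_) (abs_nonneg _)
      have hC0 : 0 ≤ C := (norm_nonneg _).trans (hC i x₀)
      rw [ContinuousMap.norm_le _ (mul_nonneg hC0 (norm_nonneg (J - h)))]
      intro u
      exact (ContinuousLinearMap.le_opNorm _ _).trans (mul_le_mul (hC j (γ u))
        ((J - h).norm_coe_le_norm u) (norm_nonneg _) hC0)
    have hJh : J = h := by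
      rw [← sub_eq_zero, ← norm_eq_zero]
      have := norm_nonneg (J - h)
      have : ∑ j, |p.1 j| * C < 1 := hpC
      nlinarith
    have hfd : fderiv ℝ (fun p ↦ ev (Γ p)) p = ev ∘L fderiv ℝ Γ p :=
      (HasFDerivAt.comp p ev.hasFDerivAt hΓd).fderiv
    rw [hfd, ContinuousLinearMap.comp_apply, ← hJ, hJh, hev]
    change h 1 = R i (ev (Γ p))
    rw [hev]
    simp [h, N, ← hγ]

end

/-! ### Smoothness and commutation of Reeb fields; invariance of the form; cut-off. -/

section

variable {E : Type*} [NormedAddCommGroup E] [NormedSpace ℝ E]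
  {F : Type*} [NormedAddCommGroup F] [NormedSpace ℝ F]

/-- The solution of a smooth family of injective linear equations with constant right-hand side
is smooth. -/
theorem contDiffOn_of_injective_clm_apply_eq [FiniteDimensional ℝ E] [FiniteDimensional ℝ F]
    {L : E → E →L[ℝ] F} {R : E → E} {c : F} {V : Set E} (hV : IsOpen V)
    (hL : ContDiffOn ℝ ∞ L V) (hinj : ∀ y ∈ V, Function.Injective (L y))
    (hR : ∀ y ∈ V, L y (R y) = c) : ContDiffOn ℝ ∞ R V := by
  have : CompleteSpace E := FiniteDimensional.complete ℝ E
  intro y₀ hy₀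
  -- With `P` a fixed left inverse of `L y₀`, the operator P ∘ L(y) is invertible near `y₀`, and
  -- R(y) = (P ∘ L(y))⁻¹ P c.
  obtain ⟨P₀, hP₀⟩ := LinearMap.exists_leftInverse_of_injective (L y₀ : E →ₗ[ℝ] F)
    (LinearMap.ker_eq_bot.2 (hinj y₀ hy₀))
  let P : F →L[ℝ] E := P₀.toContinuousLinearMap
  have hA : ContDiffAt ℝ ∞ (fun y ↦ P ∘L L y) y₀ :=
    contDiffAt_const.clm_comp (hL.contDiffAt (hV.mem_nhds hy₀))
  have hA₀ : P ∘L L y₀ = (ContinuousLinearEquiv.refl ℝ E : E →L[ℝ] E) :=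
    ContinuousLinearMap.ext fun v ↦ LinearMap.congr_fun hP₀ v
  have hinv : ContDiffAt ℝ ∞ (fun y ↦ ContinuousLinearMap.inverse (P ∘L L y) (P c)) y₀ := by
    refine ContDiffAt.clm_apply ?_ contDiffAt_const
    refine ContDiffAt.comp y₀ (g := ContinuousLinearMap.inverse) ?_ hA
    rw [hA₀]
    exact contDiffAt_map_inverse _
  refine (hinv.congr_of_eventuallyEq ?_).contDiffWithinAt
  have hmem : Set.range ((↑) : (E ≃L[ℝ] E) → E →L[ℝ] E) ∈ 𝓝 (P ∘L L y₀) := by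
    rw [hA₀]; exact ContinuousLinearEquiv.nhds _
  filter_upwards [hV.mem_nhds hy₀, hA.continuousAt hmem] with y hy ⟨A, hAy⟩
  have hAy' : P ∘L L y = A := hAy.symm
  rw [hAy', ContinuousLinearMap.inverse_equiv, ← hR y hy]
  have : P (L y (R y)) = A (R y) := congrArg (fun B : E →L[ℝ] E ↦ B (R y)) hAy'
  simp [this]

/-- Vector fields with constant values under `θ` that annihilate `dθ` commute, if `θ` and `dθ`
have no common kernel. -/
theorem fderiv_apply_comm_of_reeb {ι : Type*} {θ : E → E →L[ℝ] F} {R : ι → E → E} {c : ι → F}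
    {V : Set E} (hV : IsOpen V) (hθ : ContDiffOn ℝ ∞ θ V) (hR : ∀ i, ContDiffOn ℝ ∞ (R i) V)
    (hθR : ∀ y ∈ V, ∀ i, θ y (R i y) = c i)
    (hdR : ∀ y ∈ V, ∀ i w, fderiv ℝ θ y (R i y) w = fderiv ℝ θ y w (R i y))
    (hinj : ∀ y ∈ V, ∀ v, θ y v = 0 → (∀ w, fderiv ℝ θ y v w = fderiv ℝ θ y w v) → v = 0)
    {y : E} (hy : y ∈ V) (i j : ι) : fderiv ℝ (R j) y (R i y) = fderiv ℝ (R i) y (R j y) := by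
  have hVy := hV.mem_nhds hy
  have hθy : ContDiffAt ℝ ∞ θ y := hθ.contDiffAt hVy
  have hθd : HasFDerivAt θ (fderiv ℝ θ y) y := (hθy.differentiableAt (by simp)).hasFDerivAt
  have hRd (i) : HasFDerivAt (R i) (fderiv ℝ (R i) y) y :=
    (((hR i).contDiffAt hVy).differentiableAt (by simp)).hasFDerivAt
  have hDd : HasFDerivAt (fderiv ℝ θ) (fderiv ℝ (fderiv ℝ θ) y) y :=
    ((hθy.fderiv_right (m := ∞) (by simp)).differentiableAt (by simp)).hasFDerivAt
  have hsymm (a b : E) : fderiv ℝ (fderiv ℝ θ) y a b = fderiv ℝ (fderiv ℝ θ) y b a :=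
    (hθy.isSymmSndFDerivAt (by simpa using ENat.LEInfty.out)).eq a b
  -- `h1` is the derivative of θ(R_j) = c_j along `a`; `h2` is that of dθ(R_j, w) = 0.
  have h1 (j a) : fderiv ℝ θ y a (R j y) + θ y (fderiv ℝ (R j) y a) = 0 := by
    have hz : (fun y ↦ θ y (R j y)) =ᶠ[𝓝 y] fun _ ↦ c j :=
      Filter.eventually_of_mem hVy fun y hy ↦ hθR y hy j
    have := DFunLike.congr_fun ((hθd.clm_apply (hRd j)).unique
      ((hasFDerivAt_const (c j) y).congr_of_eventuallyEq hz)) a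
    simpa [add_comm] using this
  have h2 (j a w) : fderiv ℝ (fderiv ℝ θ) y a (R j y) w + fderiv ℝ θ y (fderiv ℝ (R j) y a) w =
      fderiv ℝ (fderiv ℝ θ) y a w (R j y) + fderiv ℝ θ y w (fderiv ℝ (R j) y a) := by
    have hz : (fun y ↦ fderiv ℝ θ y (R j y) w) =ᶠ[𝓝 y] fun y ↦ fderiv ℝ θ y w (R j y) :=
      Filter.eventually_of_mem hVy fun y hy ↦ hdR y hy j w
    have := DFunLike.congr_fun
      (((hDd.clm_apply (hRd j)).clm_apply (hasFDerivAt_const w y)).unique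
        (((hDd.clm_apply (hasFDerivAt_const w y)).clm_apply (hRd j)).congr_of_eventuallyEq hz)) a
    simpa [add_comm] using this
  rw [← sub_eq_zero]
  refine hinj y hy _ ?_ fun w ↦ ?_
  · have e1 := h1 j (R i y)
    have e2 := h1 i (R j y)
    rw [hdR y hy i] at e1
    rw [map_sub, sub_eq_zero]
    exact add_left_cancel (e1.trans e2.symm)
  · have e1 := h2 j (R i y) w
    have e2 := h2 i (R j y) w
    -- Pairing the derivative along `w` with R_i makes the first-derivative terms cancel. What
    -- remains matches the second-derivative terms of `e1` and `e2`, leaving dθ([R_i, R_j], w) = 0.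
    have e3 := h2 j w (R i y)
    rw [hdR y hy i (fderiv ℝ (R j) y w)] at *
    rw [← hdR y hy i (fderiv ℝ (R j) y w), add_left_inj, hsymm, hsymm w (R i y)] at e3
    rw [hsymm (R j y) (R i y), e3] at e2
    simp only [map_sub, sub_apply]
    have e1' := eq_sub_of_add_eq' e1
    have e2' := eq_sub_of_add_eq' e2
    rw [e1', e2']
    abel

/-- Cartan's formula for the pullback of `θ` along `Ψ`, in the case that the coordinate direction
`a` is mapped to a vector that annihilates `dθ` and on which `θ` is constant. -/
theorem fderiv_pullback_apply_eq_zero {Z : Type*} [NormedAddCommGroup Z] [NormedSpace ℝ Z]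
    {θ : E → E →L[ℝ] F} {Ψ : Z → E} {z a : Z} {c : F} (hΨ : ContDiffAt ℝ ∞ Ψ z)
    (hθ : DifferentiableAt ℝ θ (Ψ z)) (hc : ∀ᶠ z in 𝓝 z, θ (Ψ z) (fderiv ℝ Ψ z a) = c)
    (hd : ∀ w, fderiv ℝ θ (Ψ z) (fderiv ℝ Ψ z a) w = fderiv ℝ θ (Ψ z) w (fderiv ℝ Ψ z a))
    (b : Z) : fderiv ℝ (fun z ↦ θ (Ψ z) (fderiv ℝ Ψ z b)) z a = 0 := by
  have hΨd : HasFDerivAt Ψ (fderiv ℝ Ψ z) z := (hΨ.differentiableAt (by simp)).hasFDerivAt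
  have hDd : HasFDerivAt (fderiv ℝ Ψ) (fderiv ℝ (fderiv ℝ Ψ) z) z :=
    ((hΨ.fderiv_right (m := ∞) (by simp)).differentiableAt (by simp)).hasFDerivAt
  have hsymm : fderiv ℝ (fderiv ℝ Ψ) z a b = fderiv ℝ (fderiv ℝ Ψ) z b a :=
    (hΨ.isSymmSndFDerivAt (by simpa using ENat.LEInfty.out)).eq a b
  have hg (b : Z) : HasFDerivAt (fun z ↦ θ (Ψ z) (fderiv ℝ Ψ z b)) _ z :=
    (hθ.hasFDerivAt.comp z hΨd).clm_apply (hDd.clm_apply (hasFDerivAt_const b z))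
  -- The b-derivative of θ(∂_a Ψ) is zero. By `hsymm` it differs from the a-derivative of θ(∂_b Ψ)
  -- only by a value of dθ on ∂_a Ψ, which vanishes by `hd`.
  have h1 := DFunLike.congr_fun ((hg a).unique ((hasFDerivAt_const c z).congr_of_eventuallyEq hc)) b
  rw [(hg b).fderiv]
  simp only [add_apply, ContinuousLinearMap.comp_apply, ContinuousLinearMap.flip_apply,
    zero_apply, map_zero, zero_add, Function.comp_apply] at h1 ⊢
  rw [hsymm, hd, h1]

/-- A smooth vector field on an open set agrees near a point with a globally defined smooth
vector field of bounded derivative. -/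
theorem ContDiffOn.exists_contDiff_eventuallyEq [FiniteDimensional ℝ E] {R : E → F} {V : Set E}
    (hV : IsOpen V) (hR : ContDiffOn ℝ ∞ R V) {y₀ : E} (hy₀ : y₀ ∈ V) :
    ∃ (S : E → F) (C : ℝ), ContDiff ℝ ∞ S ∧ (∀ y, ‖fderiv ℝ S y‖ ≤ C) ∧ S =ᶠ[𝓝 y₀] R := by
  obtain ⟨r, hr, hrV⟩ := Metric.isOpen_iff.1 hV y₀ hy₀
  let χ : ContDiffBump y₀ := ⟨r / 4, r / 2, by positivity, by linarith⟩
  have hχV : tsupport χ ⊆ V := by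
    rw [χ.tsupport_eq]
    exact (Metric.closedBall_subset_ball (by simp [χ]; linarith)).trans hrV
  have hS : ContDiff ℝ ∞ fun y ↦ χ y • R y := by
    refine contDiff_iff_contDiffAt.2 fun y ↦ ?_
    by_cases hy : y ∈ tsupport χ
    · exact χ.contDiffAt.smul (hR.contDiffAt (hV.mem_nhds (hχV hy)))
    · refine (contDiffAt_const (c := (0 : F))).congr_of_eventuallyEq ?_
      filter_upwards [notMem_tsupport_iff_eventuallyEq.1 hy] with x hx
      simp [hx]
  have hcs : HasCompactSupport fun y ↦ χ y • R y := χ.hasCompactSupport.smul_right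
  obtain ⟨C, hC⟩ := (hcs.fderiv ℝ).exists_bound_of_continuous (hS.continuous_fderiv (by simp))
  refine ⟨_, C, hS, hC, ?_⟩
  filter_upwards [χ.eventuallyEq_one] with y hy
  simp [hy]

end

/-! ### Straightening the Reeb fields on the model space. -/

section

variable {E : Type u} [NormedAddCommGroup E] [NormedSpace ℝ E] [FiniteDimensional ℝ E]
  {ι κ : Type*} [Fintype ι] [DecidableEq ι] [Fintype κ]

/-- A surjective linear map `T : E → ℝ^ι` with sections `v i` of the basis vectors yields linear
coordinates on `E` adapted to `span v ⊕ ker T`. -/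
theorem exists_continuousLinearEquiv_of_apply_eq_single (T : E →L[ℝ] (ι → ℝ)) (v : ι → E)
    (hv : ∀ i, T (v i) = Pi.single i 1)
    (hcard : Module.finrank ℝ E = Fintype.card ι + Fintype.card κ) :
    ∃ (A : (κ → ℝ) →L[ℝ] E) (B : (ι ⊕ κ → ℝ) ≃L[ℝ] E),
      ∀ z, B z = ∑ i, z (Sum.inl i) • v i + A (fun J ↦ z (Sum.inr J)) := by
  have hTs (s : ι → ℝ) : T (∑ i, s i • v i) = s := by
    ext j
    simp [hv, Pi.single_apply]
  have hker : Module.finrank ℝ T.ker = Module.finrank ℝ (κ → ℝ) := by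
    have h := (T : E →ₗ[ℝ] (ι → ℝ)).finrank_range_add_finrank_ker
    rw [LinearMap.range_eq_top.2 fun s ↦ ⟨_, hTs s⟩, finrank_top,
      Module.finrank_fintype_fun_eq_card, hcard] at h
    rw [Module.finrank_fintype_fun_eq_card]
    exact add_left_cancel h
  let A₀ : (κ → ℝ) ≃ₗ[ℝ] T.ker := LinearEquiv.ofFinrankEq _ _ hker.symm
  let A : (κ → ℝ) →ₗ[ℝ] E := T.ker.subtype ∘ₗ A₀.toLinearMap
  have hTA (x : κ → ℝ) : T (A x) = 0 := (A₀ x).2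
  let B₀ : (ι ⊕ κ → ℝ) →ₗ[ℝ] E :=
    Fintype.linearCombination ℝ v ∘ₗ LinearMap.funLeft ℝ ℝ Sum.inl +
      A ∘ₗ LinearMap.funLeft ℝ ℝ Sum.inr
  have hB₀ (z) : B₀ z = ∑ i, z (Sum.inl i) • v i + A (fun J ↦ z (Sum.inr J)) := rfl
  have hinj : Function.Injective B₀ := by
    rw [← LinearMap.ker_eq_bot, LinearMap.ker_eq_bot']
    intro z hz
    have hl : (fun i ↦ z (Sum.inl i)) = 0 := by
      have := congrArg T hz
      rwa [hB₀, map_add, hTA, add_zero, hTs fun i ↦ z (Sum.inl i), map_zero] at this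
    have hr : (fun J ↦ z (Sum.inr J)) = 0 := by
      rw [hB₀] at hz
      simp only [fun i ↦ congrFun hl i, Pi.zero_apply, zero_smul, Finset.sum_const_zero,
        zero_add] at hz
      exact A₀.injective (Subtype.ext (hz.trans (by simp)))
    ext (i | J)
    · exact congrFun hl i
    · exact congrFun hr J
  refine ⟨A.toContinuousLinearMap, (LinearEquiv.ofInjectiveOfFinrankEq B₀ hinj
    (by simp [hcard])).toContinuousLinearEquiv, fun z ↦ hB₀ z⟩

/-- Adapted coordinates for commuting Reeb fields: if `R i` are commuting vector fields near `y₀`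
dual to the components of `θ` and annihilating `dθ`, there is a local diffeomorphism `e` to
`ℝ^ι × ℝ^κ` that straightens the `R i`, in which `θ i = ds i - ∑ J, f i J (x) dx J`. -/
theorem exists_coordinates_of_reeb [DecidableEq κ] {V : Set E} (hV : IsOpen V) {y₀ : E}
    (hy₀ : y₀ ∈ V)
    {θ : E → E →L[ℝ] (ι → ℝ)} (hθ : ContDiffOn ℝ ∞ θ V)
    {R : ι → E → E} (hR : ∀ i, ContDiffOn ℝ ∞ (R i) V)
    (hθR : ∀ y ∈ V, ∀ i, θ y (R i y) = Pi.single i 1)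
    (hdR : ∀ y ∈ V, ∀ i w, fderiv ℝ θ y (R i y) w = fderiv ℝ θ y w (R i y))
    (hcomm : ∀ y ∈ V, ∀ i j, fderiv ℝ (R j) y (R i y) = fderiv ℝ (R i) y (R j y))
    (hcard : Module.finrank ℝ E = Fintype.card ι + Fintype.card κ) :
    ∃ e : OpenPartialHomeomorph E (ι ⊕ κ → ℝ), y₀ ∈ e.source ∧ e.source ⊆ V ∧
      ContDiffOn ℝ ∞ e e.source ∧ ContDiffOn ℝ ∞ e.symm e.target ∧
      (∀ z ∈ e.target, ∀ i, fderiv ℝ e.symm z (Pi.single (Sum.inl i) 1) = R i (e.symm z)) ∧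
      ∃ f : ι → κ → (κ → ℝ) → ℝ,
        (∀ i J, ContDiffOn ℝ ∞ (f i J) ((fun z J' ↦ z (Sum.inr J')) '' e.target)) ∧
        ∀ z ∈ e.target, ∀ v i, θ (e.symm z) (fderiv ℝ e.symm z v) i =
          v (Sum.inl i) - ∑ J, f i J (fun J' ↦ z (Sum.inr J')) * v (Sum.inr J) := by
  have : CompleteSpace E := FiniteDimensional.complete ℝ E
  -- The flow construction needs globally defined fields with bounded derivative; the cut-off fields
  -- agree with R_i, and so commute, only near `y₀`.
  choose S C hS hSC hSR using fun i ↦ (hR i).exists_contDiff_eventuallyEq hV hy₀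
  obtain ⟨V₁, hV₁, hV₁o, hy₀V₁⟩ : ∃ V₁ ⊆ V ∩ {y | ∀ i, S i y = R i y}, IsOpen V₁ ∧ y₀ ∈ V₁ :=
    mem_nhds_iff.1 (Filter.inter_mem (hV.mem_nhds hy₀) (Filter.eventually_all.2 hSR))
  have hSRd (y) (hy : y ∈ V₁) (i) : fderiv ℝ (S i) y = fderiv ℝ (R i) y :=
    Filter.EventuallyEq.fderiv_eq
      (Filter.eventually_of_mem (hV₁o.mem_nhds hy) fun x hx ↦ (hV₁ hx).2 i)
  obtain ⟨U, Φ, hU, h0U, hΦ, hΦ0, hΦR⟩ := exists_contDiffOn_flow_of_commute hS (C := ∑ i, |C i|)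
    (fun i y ↦ (hSC i y).trans ((le_abs_self _).trans
      (Finset.single_le_sum (f := fun i ↦ |C i|) (fun _ _ ↦ abs_nonneg _) (Finset.mem_univ i))))
    (hV₁o.mem_nhds hy₀V₁) (fun y hy i j ↦ by
      rw [hSRd y hy, hSRd y hy, (hV₁ hy).2, (hV₁ hy).2]; exact hcomm y (hV₁ hy).1 i j)
  obtain ⟨A, B, hB⟩ := exists_continuousLinearEquiv_of_apply_eq_single (κ := κ) (θ y₀)
    (fun i ↦ R i y₀) (hθR y₀ hy₀) hcard
  let πl : (ι ⊕ κ → ℝ) →L[ℝ] (ι → ℝ) := .pi fun i ↦ .proj (Sum.inl i)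
  let πr : (ι ⊕ κ → ℝ) →L[ℝ] (κ → ℝ) := .pi fun J ↦ .proj (Sum.inr J)
  let M : (ι ⊕ κ → ℝ) →L[ℝ] (ι → ℝ) × E := πl.prod (A ∘L πr)
  let l : (ι ⊕ κ → ℝ) → (ι → ℝ) × E := fun z ↦ (0, y₀) + M z
  have hl : ContDiff ℝ ∞ l := contDiff_const.add M.contDiff
  have hld (z) : HasFDerivAt l M z := M.hasFDerivAt.const_add _
  have hl0 : l 0 = (0, y₀) := by simp [l]
  -- Ψ(s, x) flows the point y₀ + A x of the slice for time s; its derivative at 0 is the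
  -- isomorphism `B`.
  let Ψ : (ι ⊕ κ → ℝ) → E := Φ ∘ l
  have hlU : IsOpen (l ⁻¹' U) := hU.preimage hl.continuous
  have hΨ : ContDiffOn ℝ ∞ Ψ (l ⁻¹' U) := hΦ.comp hl.contDiffOn fun _ h ↦ h
  have hΦd {p} (hp : p ∈ U) : HasFDerivAt Φ (fderiv ℝ Φ p) p :=
    ((hΦ.contDiffAt (hU.mem_nhds hp)).differentiableAt (by simp)).hasFDerivAt
  have hΨd (z) (hz : l z ∈ U) : HasFDerivAt Ψ (fderiv ℝ Φ (l z) ∘L M) z := (hΦd hz).comp z (hld z)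
  have hMl (i) : M (Pi.single (Sum.inl i) 1) = (Pi.single i 1, 0) := by
    refine Prod.ext ?_ ?_
    · ext j; simp [M, πl, Pi.single_apply]
    · have : πr (Pi.single (Sum.inl i) 1) = 0 := by ext J; simp [πr]
      simp [M, this]
  have hΨ0 : Ψ 0 = y₀ := by
    have := hΦ0 y₀ h0U
    simpa [Ψ, hl0] using this
  let W : Set (ι ⊕ κ → ℝ) := l ⁻¹' U ∩ Ψ ⁻¹' V₁
  have hW : IsOpen W := hΨ.continuousOn.isOpen_inter_preimage hlU hV₁o
  have h0W : (0 : ι ⊕ κ → ℝ) ∈ W := ⟨by simpa [hl0] using h0U, by simpa [hΨ0] using hy₀V₁⟩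
  have hΨR (z) (hz : z ∈ W) (i) : fderiv ℝ Ψ z (Pi.single (Sum.inl i) 1) = R i (Ψ z) := by
    rw [(hΨd z hz.1).fderiv, ContinuousLinearMap.comp_apply, hMl, hΦR _ hz.1]
    exact (hV₁ hz.2).2 i
  have hB' : HasFDerivAt Ψ (B : (ι ⊕ κ → ℝ) →L[ℝ] E) 0 := by
    refine (hΨd 0 h0W.1).congr_fderiv (ContinuousLinearMap.ext fun z ↦ ?_)
    have hx (w : E) : fderiv ℝ Φ (0, y₀) (0, w) = w := by
      have h1 : HasFDerivAt (fun x ↦ Φ (0, x)) _ y₀ :=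
        HasFDerivAt.comp y₀ (hΦd h0U) (hasFDerivAt_prodMk_right 0 y₀)
      have h2 : (fun x ↦ Φ (0, x)) =ᶠ[𝓝 y₀] id :=
        Filter.eventually_of_mem ((hU.preimage (Continuous.prodMk_right 0)).mem_nhds h0U) hΦ0
      exact DFunLike.congr_fun (h1.unique ((hasFDerivAt_id y₀).congr_of_eventuallyEq h2)) w
    have hMz : M z = ∑ i, z (Sum.inl i) • (Pi.single i 1, 0) + (0, A (πr z)) := by
      refine Prod.ext ?_ ?_
      · ext j; simp [M, πl, Prod.fst_sum, Pi.single_apply]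
      · simp [M, Prod.snd_sum]
    rw [ContinuousLinearMap.comp_apply, hl0, hMz, map_add, hx, map_sum]
    simp only [map_smul, hΦR _ h0U, hΦ0 _ h0U, (hV₁ hy₀V₁).2 _]
    exact (hB z).symm
  obtain ⟨e', h0e', he'W, he'coe, he'symm⟩ :=
    (hΨ.mono Set.inter_subset_left).exists_openPartialHomeomorph hW h0W hB'
  -- Balls of the sup norm are cubes: they contain (0, x) along with (s, x), and their s-slices are
  -- convex. Both facts are needed to make the coefficients functions of x alone.
  obtain ⟨r, hr, hrs⟩ := Metric.isOpen_iff.1 e'.open_source 0 h0e'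
  let e := (e'.restrOpen (Metric.ball 0 r) Metric.isOpen_ball).symm
  have het : e.target = Metric.ball 0 r := by
    simpa [e] using hrs
  have hes : ⇑e.symm = Ψ := he'coe
  have hball : Metric.ball 0 r ⊆ W := hrs.trans he'W
  have hΨW {z} (hz : z ∈ W) : ContDiffAt ℝ ∞ Ψ z := hΨ.contDiffAt (hlU.mem_nhds hz.1)
  have hθΨ {z} (hz : z ∈ W) : ContDiffAt ℝ ∞ θ (Ψ z) := hθ.contDiffAt (hV.mem_nhds (hV₁ hz.2).1)
  let g : κ → (ι ⊕ κ → ℝ) → (ι → ℝ) := fun J z ↦ θ (Ψ z) (fderiv ℝ Ψ z (Pi.single (Sum.inr J) 1))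
  have hg (J) {z} (hz : z ∈ W) : ContDiffAt ℝ ∞ (g J) z :=
    ((hθΨ hz).comp z (hΨW hz)).clm_apply
      (((hΨW hz).fderiv_right (m := ∞) (by simp)).clm_apply contDiffAt_const)
  have hgd (J) {z} (hz : z ∈ W) (i) : fderiv ℝ (g J) z (Pi.single (Sum.inl i) 1) = 0 := by
    refine fderiv_pullback_apply_eq_zero (hΨW hz) ((hθΨ hz).differentiableAt (by simp))
      (c := Pi.single i 1) ?_ (fun w ↦ ?_) _
    · filter_upwards [hW.mem_nhds hz] with z hz
      rw [hΨR z hz, hθR _ (hV₁ hz.2).1]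
    · rw [hΨR z hz]
      exact hdR _ (hV₁ hz.2).1 i w
  let σ : (κ → ℝ) → (ι ⊕ κ → ℝ) := fun x ↦ Sum.elim 0 x
  have hσ : ContDiff ℝ ∞ σ := by
    refine contDiff_pi.2 fun a ↦ ?_
    rcases a with i | J
    · exact contDiff_const
    · exact contDiff_apply ℝ ℝ J
  have hσball {z : ι ⊕ κ → ℝ} (hz : z ∈ Metric.ball 0 r) : σ (πr z) ∈ Metric.ball 0 r := by
    rw [mem_ball_zero_iff, pi_norm_lt_iff hr] at hz ⊢
    rintro (i | J)
    · simpa [σ] using hr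
    · exact hz (Sum.inr J)
  have hgσ (J) {z} (hz : z ∈ Metric.ball 0 r) : g J z = g J (σ (πr z)) := by
    let τ : (ι → ℝ) → (ι ⊕ κ → ℝ) := fun s ↦ Sum.elim s (πr z)
    let T : (ι → ℝ) →L[ℝ] (ι ⊕ κ → ℝ) := .pi (Sum.elim (fun i ↦ .proj i) 0)
    have hτT (s) : τ s = τ 0 + T s := by
      ext (i | J) <;> simp [τ, T]
    have hτd (s) : HasFDerivAt τ T s := by
      rw [show τ = fun s ↦ τ 0 + T s from funext hτT]
      exact T.hasFDerivAt.const_add _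
    have hτW {s} (hs : s ∈ Metric.ball (0 : ι → ℝ) r) : τ s ∈ W := by
      apply hball
      rw [mem_ball_zero_iff, pi_norm_lt_iff hr] at hs hz ⊢
      rintro (i | J)
      · exact hs i
      · exact hz (Sum.inr J)
    have hgτ {s} (hs : s ∈ Metric.ball (0 : ι → ℝ) r) :
        HasFDerivAt (fun s ↦ g J (τ s)) (fderiv ℝ (g J) (τ s) ∘L T) s :=
      HasFDerivAt.comp s ((hg J (hτW hs)).differentiableAt (by simp)).hasFDerivAt (hτd s)
    -- On the slice of fixed x all s-derivatives of the coefficient vanish by `hgd`, so it is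
    -- constant there.
    have hzero : Set.EqOn (fderiv ℝ fun s ↦ g J (τ s)) 0 (Metric.ball 0 r) := by
      intro s hs
      rw [(hgτ hs).fderiv]
      refine ContinuousLinearMap.coe_inj.1 (LinearMap.pi_ext' fun i ↦ LinearMap.ext_ring ?_)
      have : T (Pi.single i 1) = Pi.single (Sum.inl i) 1 := by
        ext (j | J) <;> simp [T, Pi.single_apply]
      simp [this, hgd J (hτW hs)]
    have hzτ : z = τ (πl z) := by
      ext (i | J) <;> rfl
    have hzl : πl z ∈ Metric.ball 0 r := by
      rw [mem_ball_zero_iff, pi_norm_lt_iff hr] at hz ⊢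
      exact fun i ↦ hz (Sum.inl i)
    conv_lhs => rw [hzτ]
    exact Metric.isOpen_ball.is_const_of_fderiv_eq_zero (convex_ball _ _).isPreconnected
      (fun s hs ↦ (hgτ hs).differentiableAt.differentiableWithinAt) hzero hzl
      (Metric.mem_ball_self hr)
  -- The sign comes from the normal form ds - ∑ f dx.
  refine ⟨e, ?_, ?_, ?_, ?_, ?_, fun i J x ↦ -(g J (σ x) i), fun i J ↦ ?_, ?_⟩
  · have := e.map_target (x := 0) (by simpa [het] using hr)
    rwa [hes, hΨ0] at this
  · intro y hy
    have := e.map_source hy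
    rw [het] at this
    have := (hV₁ (hball this).2).1
    rwa [← hes, e.left_inv hy] at this
  · exact he'symm.mono fun y hy ↦ by simpa [e] using hy.1
  · rw [hes, het]
    exact fun z hz ↦ (hΨW (hball hz)).contDiffWithinAt
  · rw [hes, het]
    exact fun z hz ↦ hΨR z (hball hz)
  · rintro _ ⟨z, hz, rfl⟩
    rw [het] at hz
    have := (hg J (hball (hσball hz))).comp (πr z) hσ.contDiffAt
    exact (((contDiff_apply ℝ ℝ i).contDiffAt.comp _ this).neg).contDiffWithinAt
  · rw [hes, het]
    intro z hz v i
    have hv : v = ∑ j, v (Sum.inl j) • Pi.single (Sum.inl j) 1 +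
        ∑ J, v (Sum.inr J) • Pi.single (Sum.inr J) 1 := by
      ext (j | J) <;> simp [Pi.single_apply]
    have hfin : θ (Ψ z) (fderiv ℝ Ψ z v) =
        ∑ j, v (Sum.inl j) • Pi.single j 1 + ∑ J, v (Sum.inr J) • g J (σ (πr z)) := by
      conv_lhs => rw [hv]
      simp only [map_add, map_sum, map_smul, hΨR z (hball hz), hθR _ (hV₁ (hball hz).2).1,
        ← hgσ _ hz, g]
    rw [hfin]
    simp [Pi.single_apply, πr, mul_comm, sub_eq_add_neg]

end

/-! ### One-forms and their exterior derivative in a chart. -/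

theorem extDeriv_ofSubsingleton_apply {E F : Type*} [NormedAddCommGroup E] [NormedSpace ℝ E]
    [NormedAddCommGroup F] [NormedSpace ℝ F] {θ : E → E →L[ℝ] F} {y : E}
    (hθ : DifferentiableAt ℝ θ y) (a b : E) :
    extDeriv (fun y ↦ ContinuousAlternatingMap.ofSubsingleton ℝ E F (0 : Fin 1) (θ y)) y ![a, b] =
      fderiv ℝ θ y a b - fderiv ℝ θ y b a := by
  have h : HasFDerivAt
      (fun y ↦ ContinuousAlternatingMap.ofSubsingleton ℝ E F (0 : Fin 1) (θ y)) _ y :=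
    HasFDerivAt.comp y (ContinuousAlternatingMap.ofSubsingletonLIE (𝕜 := ℝ) (E := E) (F := F)
      (0 : Fin 1)).toContinuousLinearEquiv.hasFDerivAt hθ.hasFDerivAt
  rw [extDeriv, h.fderiv]
  simp [ContinuousAlternatingMap.alternatizeUncurryFin_apply, Fin.sum_univ_two, sub_eq_add_neg,
    Fin.removeNth]

noncomputable section
namespace KContact

section

variable {n k : ℕ} {M : Type*} [TopologicalSpace M] [ChartedSpace (EuclideanSpace ℝ (Fin n)) M]

/-- The pullback `(φ⁻¹)^* η` along the preferred chart `φ` at `p`, as a field of linear maps on the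
model space. -/
def Form.chartRep (η : Form n k M) (p : M) (y : EuclideanSpace ℝ (Fin n)) :
    EuclideanSpace ℝ (Fin n) →L[ℝ] (Fin k → ℝ) :=
  (η ((extChartAt (𝓡 n) p).symm y)).comp
    (mfderiv 𝓘(ℝ, EuclideanSpace ℝ (Fin n)) (𝓡 n) (extChartAt (𝓡 n) p).symm y)

theorem Form.chartRep_apply (η : Form n k M) (p : M) (y v : EuclideanSpace ℝ (Fin n)) :
    η.chartRep p y v = η ((extChartAt (𝓡 n) p).symm y)
      (mfderiv 𝓘(ℝ, EuclideanSpace ℝ (Fin n)) (𝓡 n) (extChartAt (𝓡 n) p).symm y v) := rfl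

variable [IsManifold (𝓡 n) ∞ M]

theorem mfderiv_extChartAt_symm_apply {p q : M}
    (hq : q ∈ (chartAt (EuclideanSpace ℝ (Fin n)) p).source)
    (v : TangentSpace (𝓡 n) q) :
    mfderiv 𝓘(ℝ, EuclideanSpace ℝ (Fin n)) (𝓡 n) (extChartAt (𝓡 n) p).symm (extChartAt (𝓡 n) p q)
      (mfderiv (𝓡 n) 𝓘(ℝ, EuclideanSpace ℝ (Fin n)) (extChartAt (𝓡 n) p) q v) = v := by
  have : IsManifold (𝓡 n) 1 M := .of_le (n := ∞) (by simp)
  have := mfderivWithin_extChartAt_symm_comp_mfderiv_extChartAt' (I := 𝓡 n) (x := p) (y := q)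
    (by simpa using hq)
  simp only [modelWithCornersSelf_coe, Set.range_id, mfderivWithin_univ] at this
  exact DFunLike.congr_fun this v

theorem mfderiv_extChartAt_apply {p : M} {y : EuclideanSpace ℝ (Fin n)}
    (hy : y ∈ (chartAt (EuclideanSpace ℝ (Fin n)) p).target)
    (v : EuclideanSpace ℝ (Fin n)) :
    mfderiv (𝓡 n) 𝓘(ℝ, EuclideanSpace ℝ (Fin n)) (extChartAt (𝓡 n) p) ((extChartAt (𝓡 n) p).symm y)
      (mfderiv 𝓘(ℝ, EuclideanSpace ℝ (Fin n)) (𝓡 n) (extChartAt (𝓡 n) p).symm y v) = v := by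
  have : IsManifold (𝓡 n) 1 M := .of_le (n := ∞) (by simp)
  have := mfderiv_extChartAt_comp_mfderivWithin_extChartAt_symm (I := 𝓡 n) (x := p) (y := y)
    (by simpa using hy)
  simp only [modelWithCornersSelf_coe, Set.range_id, mfderivWithin_univ] at this
  exact DFunLike.congr_fun this v

/-- The trivialization of the tangent bundle at p is inverted by the derivative of the inverse
chart, so the section η read in the induced trivialization of Hom(TM, ℝ^k) is exactly `chartRep`. -/
theorem IsSmoothForm.contDiffOn_chartRep {η : Form n k M} (hη : IsSmoothForm η) (p : M) :
    ContDiffOn ℝ ∞ (η.chartRep p) (chartAt (EuclideanSpace ℝ (Fin n)) p).target := by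
  have : IsManifold (𝓡 n) 1 M := .of_le (n := ∞) (by simp)
  have h1 := ((trivializationAt (EuclideanSpace ℝ (Fin n) →L[ℝ] (Fin k → ℝ))
    (fun x ↦ TangentSpace (𝓡 n) x →L[ℝ] Bundle.Trivial M (Fin k → ℝ) x)
      p).contMDiffOn_section_baseSet_iff (IB := 𝓡 n) (n := ∞) (s := η)).1 hη.contMDiffOn
  have h2 : ContMDiffOn 𝓘(ℝ, EuclideanSpace ℝ (Fin n)) (𝓡 n) ∞ (extChartAt (𝓡 n) p).symm
      (chartAt (EuclideanSpace ℝ (Fin n)) p).target := by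
    simpa using contMDiffOn_extChartAt_symm (I := 𝓡 n) (n := ∞) p
  have h3 := h1.comp h2 (fun y hy ↦ by
    simpa using (chartAt (EuclideanSpace ℝ (Fin n)) p).map_target hy)
  refine (contMDiffOn_iff_contDiffOn.1 h3).congr fun y hy ↦ ?_
  have hq := (chartAt (EuclideanSpace ℝ (Fin n)) p).map_target hy
  have hs := TangentBundle.symmL_trivializationAt (I := 𝓡 n) hq
  simp only [modelWithCornersSelf_coe, Set.range_id, mfderivWithin_univ] at hs
  have hr : extChartAt (𝓡 n) p ((chartAt (EuclideanSpace ℝ (Fin n)) p).symm y) = y := by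
    simpa using (chartAt (EuclideanSpace ℝ (Fin n)) p).right_inv hy
  rw [hr] at hs
  rw [Function.comp_apply, hom_trivializationAt_apply, ContinuousLinearMap.inCoordinates]
  ext v
  simp [Form.chartRep, hs]

/-- Naturality of the exterior derivative under the transition map τ from the chart at q to the
chart at p. It allows the chart at p to be used at all nearby points. -/
theorem Form.d_apply {η : Form n k M} (hη : IsSmoothForm η) {p q : M}
    (hq : q ∈ (chartAt (EuclideanSpace ℝ (Fin n)) p).source) (a b : TangentSpace (𝓡 n) q) :
    η.d q ![a, b] =
      fderiv ℝ (η.chartRep p) (extChartAt (𝓡 n) p q)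
        (mfderiv (𝓡 n) 𝓘(ℝ, EuclideanSpace ℝ (Fin n)) (extChartAt (𝓡 n) p) q a)
        (mfderiv (𝓡 n) 𝓘(ℝ, EuclideanSpace ℝ (Fin n)) (extChartAt (𝓡 n) p) q b) -
      fderiv ℝ (η.chartRep p) (extChartAt (𝓡 n) p q)
        (mfderiv (𝓡 n) 𝓘(ℝ, EuclideanSpace ℝ (Fin n)) (extChartAt (𝓡 n) p) q b)
        (mfderiv (𝓡 n) 𝓘(ℝ, EuclideanSpace ℝ (Fin n)) (extChartAt (𝓡 n) p) q a) := by
  have : IsManifold (𝓡 n) 1 M := .of_le (n := ∞) (by simp)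
  let τ : EuclideanSpace ℝ (Fin n) → EuclideanSpace ℝ (Fin n) := fun y ↦
    extChartAt (𝓡 n) p ((extChartAt (𝓡 n) q).symm y)
  set y₀ : EuclideanSpace ℝ (Fin n) := extChartAt (𝓡 n) q q with hy₀
  have hc'q : (extChartAt (𝓡 n) q).symm y₀ = q := extChartAt_to_inv q
  have hy₀t : y₀ ∈ (chartAt (EuclideanSpace ℝ (Fin n)) q).target := by
    simp [hy₀]
  have hc'smooth : ContMDiffOn 𝓘(ℝ, EuclideanSpace ℝ (Fin n)) (𝓡 n) ∞ (extChartAt (𝓡 n) q).symm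
      (chartAt (EuclideanSpace ℝ (Fin n)) q).target := by
    simpa using contMDiffOn_extChartAt_symm (I := 𝓡 n) (n := ∞) q
  have hc'at {y} (hy : y ∈ (chartAt (EuclideanSpace ℝ (Fin n)) q).target) :
      ContMDiffAt 𝓘(ℝ, EuclideanSpace ℝ (Fin n)) (𝓡 n) ∞ (extChartAt (𝓡 n) q).symm y :=
    hc'smooth.contMDiffAt ((chartAt (EuclideanSpace ℝ (Fin n)) q).open_target.mem_nhds hy)
  have hc's {y} (hy : y ∈ (chartAt (EuclideanSpace ℝ (Fin n)) q).target) :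
      MDifferentiableAt 𝓘(ℝ, EuclideanSpace ℝ (Fin n)) (𝓡 n) (extChartAt (𝓡 n) q).symm y :=
    (hc'at hy).mdifferentiableAt (by simp)
  have hq' : (extChartAt (𝓡 n) q).symm y₀ ∈ (chartAt (EuclideanSpace ℝ (Fin n)) p).source := by
    rwa [hc'q]
  have hev : ∀ᶠ y in 𝓝 y₀, y ∈ (chartAt (EuclideanSpace ℝ (Fin n)) q).target ∧
      (extChartAt (𝓡 n) q).symm y ∈ (chartAt (EuclideanSpace ℝ (Fin n)) p).source :=
    Filter.Eventually.and ((chartAt (EuclideanSpace ℝ (Fin n)) q).open_target.mem_nhds hy₀t)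
      ((hc'at hy₀t).continuousAt.preimage_mem_nhds
        ((chartAt (EuclideanSpace ℝ (Fin n)) p).open_source.mem_nhds hq'))
  have hcs {x} (hx : x ∈ (chartAt (EuclideanSpace ℝ (Fin n)) p).source) :
      MDifferentiableAt (𝓡 n) 𝓘(ℝ, EuclideanSpace ℝ (Fin n)) (extChartAt (𝓡 n) p) x :=
    mdifferentiableAt_extChartAt hx
  have hτ : ContDiffAt ℝ ∞ τ y₀ := contMDiffAt_iff_contDiffAt.1 <|
    ContMDiffAt.comp y₀ (contMDiffAt_extChartAt' hq') (hc'at hy₀t)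
  have hτd {y} (h1 : y ∈ (chartAt (EuclideanSpace ℝ (Fin n)) q).target)
      (h2 : (extChartAt (𝓡 n) q).symm y ∈ (chartAt (EuclideanSpace ℝ (Fin n)) p).source)
      (v : EuclideanSpace ℝ (Fin n)) :
      fderiv ℝ τ y v =
        mfderiv (𝓡 n) 𝓘(ℝ, EuclideanSpace ℝ (Fin n)) (extChartAt (𝓡 n) p)
          ((extChartAt (𝓡 n) q).symm y)
          (mfderiv 𝓘(ℝ, EuclideanSpace ℝ (Fin n)) (𝓡 n) (extChartAt (𝓡 n) q).symm y v) := by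
    rw [← mfderiv_eq_fderiv]
    exact DFunLike.congr_fun (mfderiv_comp y (hcs h2) (hc's h1)) v
  have hpull : η.inChart q =ᶠ[𝓝 y₀]
      fun y ↦ (η.inChart p (τ y)).compContinuousLinearMap (fderiv ℝ τ y) := by
    filter_upwards [hev] with y ⟨h1, h2⟩
    have hcc : (extChartAt (𝓡 n) p).symm (τ y) = (extChartAt (𝓡 n) q).symm y :=
      (extChartAt (𝓡 n) p).left_inv (by simpa using h2)
    ext1 v
    change η ((extChartAt (𝓡 n) q).symm y)
        (mfderiv 𝓘(ℝ, EuclideanSpace ℝ (Fin n)) (𝓡 n) (extChartAt (𝓡 n) q).symm y (v 0)) =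
      η ((extChartAt (𝓡 n) p).symm (τ y))
        (mfderiv 𝓘(ℝ, EuclideanSpace ℝ (Fin n)) (𝓡 n) (extChartAt (𝓡 n) p).symm (τ y)
          (fderiv ℝ τ y (v 0)))
    rw [hτd h1 h2, mfderiv_extChartAt_symm_apply h2, hcc]
  have hfin : τ y₀ = extChartAt (𝓡 n) p q := congrArg (extChartAt (𝓡 n) p) hc'q
  have hθ : DifferentiableAt ℝ (η.chartRep p) (τ y₀) := by
    refine ((hη.contDiffOn_chartRep p).contDiffAt
      ((chartAt (EuclideanSpace ℝ (Fin n)) p).open_target.mem_nhds ?_)).differentiableAt (by simp)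
    rw [hfin]
    simpa using (chartAt (EuclideanSpace ℝ (Fin n)) p).map_source hq
  have hin : DifferentiableAt ℝ (η.inChart p) (τ y₀) :=
    (ContinuousAlternatingMap.ofSubsingletonLIE (𝕜 := ℝ) (E := EuclideanSpace ℝ (Fin n))
      (F := Fin k → ℝ) (0 : Fin 1)).toContinuousLinearEquiv.differentiableAt.comp (τ y₀) hθ
  have hD (a : TangentSpace (𝓡 n) q) :
      fderiv ℝ τ y₀ (mfderiv (𝓡 n) 𝓘(ℝ, EuclideanSpace ℝ (Fin n)) (extChartAt (𝓡 n) q) q a) =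
        mfderiv (𝓡 n) 𝓘(ℝ, EuclideanSpace ℝ (Fin n)) (extChartAt (𝓡 n) p) q a := by
    refine (hτd hy₀t hq' _).trans ((congrArg (mfderiv (𝓡 n) 𝓘(ℝ, EuclideanSpace ℝ (Fin n))
      (extChartAt (𝓡 n) p) ((extChartAt (𝓡 n) q).symm y₀))
        (mfderiv_extChartAt_symm_apply (mem_chart_source _ q) a)).trans ?_)
    rw [hc'q]
  rw [Form.d, hpull.extDeriv_eq, extDeriv_pullback hin hτ (by simpa using ENat.LEInfty.out)]
  have hvec : (fun i ↦ fderiv ℝ τ y₀ (mfderiv (𝓡 n) 𝓘(ℝ, EuclideanSpace ℝ (Fin n))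
      (extChartAt (𝓡 n) q) q (![a, b] i))) =
      ![mfderiv (𝓡 n) 𝓘(ℝ, EuclideanSpace ℝ (Fin n)) (extChartAt (𝓡 n) p) q a,
        mfderiv (𝓡 n) 𝓘(ℝ, EuclideanSpace ℝ (Fin n)) (extChartAt (𝓡 n) p) q b] := by
    ext1 i
    fin_cases i
    · exact hD a
    · exact hD b
  refine (congrArg (extDeriv (η.inChart p) (τ y₀)) hvec).trans ?_
  rw [hfin] at hθ ⊢
  exact extDeriv_ofSubsingleton_apply hθ _ _

end

end KContact
end

/-! ### Reeb fields in a chart. -/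

theorem OpenPartialHomeomorph.fderiv_fderiv_symm_apply {E F : Type*} [NormedAddCommGroup E]
    [NormedSpace ℝ E] [NormedAddCommGroup F] [NormedSpace ℝ F] (e : OpenPartialHomeomorph E F)
    {z : F} (hz : z ∈ e.target) (h : DifferentiableAt ℝ e (e.symm z))
    (h' : DifferentiableAt ℝ e.symm z) (w : F) :
    fderiv ℝ e (e.symm z) (fderiv ℝ e.symm z w) = w :=
  DFunLike.congr_fun ((h.hasFDerivAt.comp z h'.hasFDerivAt).unique
    ((hasFDerivAt_id z).congr_of_eventuallyEq (e.eventually_right_inverse hz))) w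

theorem ContinuousLinearMap.contDiff_flip {E F G : Type*} [NormedAddCommGroup E] [NormedSpace ℝ E]
    [NormedAddCommGroup F] [NormedSpace ℝ F] [NormedAddCommGroup G] [NormedSpace ℝ G] :
    ContDiff ℝ ∞ fun A : E →L[ℝ] F →L[ℝ] G ↦ A.flip :=
  LinearIsometryEquiv.contDiff (𝕜 := ℝ) (E := E →L[ℝ] F →L[ℝ] G) (F := F →L[ℝ] E →L[ℝ] G)
    (ContinuousLinearMap.flipₗᵢ ℝ E F G)

namespace KContact

section

variable {n : ℕ} {M : Type*} [TopologicalSpace M] [ChartedSpace (EuclideanSpace ℝ (Fin n)) M]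
  {p : M} {y : EuclideanSpace ℝ (Fin n)}

theorem extChartAt_symm_mem_source (hy : y ∈ (chartAt (EuclideanSpace ℝ (Fin n)) p).target) :
    (extChartAt (𝓡 n) p).symm y ∈ (chartAt (EuclideanSpace ℝ (Fin n)) p).source := by
  simpa using (chartAt (EuclideanSpace ℝ (Fin n)) p).map_target hy

theorem extChartAt_extChartAt_symm (hy : y ∈ (chartAt (EuclideanSpace ℝ (Fin n)) p).target) :
    extChartAt (𝓡 n) p ((extChartAt (𝓡 n) p).symm y) = y :=
  (extChartAt (𝓡 n) p).right_inv (by simpa using hy)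

theorem Form.chartRep_extChartAt_apply {k : ℕ} (η : Form n k M) {q : M}
    (hq : q ∈ (chartAt (EuclideanSpace ℝ (Fin n)) p).source) (v : EuclideanSpace ℝ (Fin n)) :
    η.chartRep p (extChartAt (𝓡 n) p q) v = η q (mfderiv 𝓘(ℝ, EuclideanSpace ℝ (Fin n)) (𝓡 n)
      (extChartAt (𝓡 n) p).symm (extChartAt (𝓡 n) p q) v) := by
  rw [Form.chartRep_apply, (extChartAt (𝓡 n) p).left_inv (by simpa using hq)]

end

section

variable {n k : ℕ} {M : Type*} [TopologicalSpace M] [ChartedSpace (EuclideanSpace ℝ (Fin n)) M]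
  [IsManifold (𝓡 n) ∞ M]

/-- The Reeb vector field `R_i`, pushed forward along the preferred chart at `p`. -/
noncomputable def IsKContactForm.reebRep {η : Form n k M} (hη : IsKContactForm η) (p : M)
    (i : Fin k) (y : EuclideanSpace ℝ (Fin n)) : EuclideanSpace ℝ (Fin n) :=
  mfderiv (𝓡 n) 𝓘(ℝ, EuclideanSpace ℝ (Fin n)) (extChartAt (𝓡 n) p) ((extChartAt (𝓡 n) p).symm y)
    (hη.reeb i ((extChartAt (𝓡 n) p).symm y))

variable {p : M} {y : EuclideanSpace ℝ (Fin n)}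

theorem Form.d_chart_symm_apply {η : Form n k M} (hη : IsSmoothForm η)
    (hy : y ∈ (chartAt (EuclideanSpace ℝ (Fin n)) p).target)
    (a b : TangentSpace (𝓡 n) ((extChartAt (𝓡 n) p).symm y)) {a' b' : EuclideanSpace ℝ (Fin n)}
    (ha : mfderiv (𝓡 n) 𝓘(ℝ, EuclideanSpace ℝ (Fin n)) (extChartAt (𝓡 n) p)
      ((extChartAt (𝓡 n) p).symm y) a = a')
    (hb : mfderiv (𝓡 n) 𝓘(ℝ, EuclideanSpace ℝ (Fin n)) (extChartAt (𝓡 n) p)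
      ((extChartAt (𝓡 n) p).symm y) b = b') :
    η.d ((extChartAt (𝓡 n) p).symm y) ![a, b] =
      fderiv ℝ (η.chartRep p) y a' b' - fderiv ℝ (η.chartRep p) y b' a' := by
  have h := Form.d_apply hη (extChartAt_symm_mem_source hy) a b
  rw [extChartAt_extChartAt_symm hy] at h
  subst ha hb
  exact h

theorem IsKContactForm.chartRep_reebRep {η : Form n k M} (hη : IsKContactForm η)
    (hy : y ∈ (chartAt (EuclideanSpace ℝ (Fin n)) p).target)
    (i : Fin k) : η.chartRep p y (hη.reebRep p i y) = Pi.single i 1 := by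
  have h := mfderiv_extChartAt_symm_apply (extChartAt_symm_mem_source hy)
    (hη.reeb i ((extChartAt (𝓡 n) p).symm y))
  rw [extChartAt_extChartAt_symm hy] at h
  refine (congrArg (η ((extChartAt (𝓡 n) p).symm y)) h).trans (funext fun j ↦ ?_)
  rw [(hη.reeb_spec i _).1 j, Pi.single_apply]
  simp [eq_comm]

theorem IsKContactForm.fderiv_chartRep_reebRep {η : Form n k M} (hη : IsKContactForm η)
    (hy : y ∈ (chartAt (EuclideanSpace ℝ (Fin n)) p).target) (i : Fin k)
    (w : EuclideanSpace ℝ (Fin n)) :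
    fderiv ℝ (η.chartRep p) y (hη.reebRep p i y) w =
      fderiv ℝ (η.chartRep p) y w (hη.reebRep p i y) := by
  rw [← sub_eq_zero]
  refine (Form.d_chart_symm_apply hη.smooth hy (hη.reeb i _) _ rfl
    (mfderiv_extChartAt_apply hy w)).symm.trans ?_
  exact funext fun j ↦ (hη.reeb_spec i _).2 _ j

/-- Condition ker η ∩ ker dη = 0 carried to the chart; it supplies injectivity both for the
smoothness and for the commutation of the Reeb fields. -/
theorem IsKContactForm.eq_zero_of_chartRep {η : Form n k M} (hη : IsKContactForm η)
    (hy : y ∈ (chartAt (EuclideanSpace ℝ (Fin n)) p).target) (v : EuclideanSpace ℝ (Fin n))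
    (h1 : η.chartRep p y v = 0)
    (h2 : ∀ w, fderiv ℝ (η.chartRep p) y v w = fderiv ℝ (η.chartRep p) y w v) : v = 0 := by
  set q := (extChartAt (𝓡 n) p).symm y with hq
  let u : TangentSpace (𝓡 n) q :=
    mfderiv 𝓘(ℝ, EuclideanSpace ℝ (Fin n)) (𝓡 n) (extChartAt (𝓡 n) p).symm y v
  have hu : mfderiv (𝓡 n) 𝓘(ℝ, EuclideanSpace ℝ (Fin n)) (extChartAt (𝓡 n) p) q u = v :=
    mfderiv_extChartAt_apply hy v
  have hmem : u ∈ η.kerAt q ⊓ η.kerDAt q := by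
    refine ⟨h1, fun w ↦ ?_⟩
    exact (Form.d_chart_symm_apply hη.smooth hy u w hu rfl).trans (sub_eq_zero.2 (h2 _))
  rw [hη.ker_inf_kerD q, Submodule.mem_bot] at hmem
  rw [← hu, hmem, map_zero]
  rfl

/-- The Reeb vectors are chosen point by point, so smoothness has to be recovered from the linear
system v ↦ (η(v), ι_v dη), which is smooth in the point and injective. -/
theorem IsKContactForm.contDiffOn_reebRep {η : Form n k M} (hη : IsKContactForm η)
    (p : M) (i : Fin k) :
    ContDiffOn ℝ ∞ (hη.reebRep p i) (chartAt (EuclideanSpace ℝ (Fin n)) p).target := by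
  have ho := (chartAt (EuclideanSpace ℝ (Fin n)) p).open_target
  have hθ := hη.smooth.contDiffOn_chartRep p
  have hθ' := hθ.fderiv_of_isOpen (m := ∞) ho (by simp)
  refine contDiffOn_of_injective_clm_apply_eq (c := (Pi.single i 1, 0))
    (L := fun y ↦ ContinuousLinearMap.inl ℝ _ _ ∘L η.chartRep p y + ContinuousLinearMap.inr ℝ _ _ ∘L
      (fderiv ℝ (η.chartRep p) y - (fderiv ℝ (η.chartRep p) y).flip)) ho ?_ ?_ ?_
  · refine (contDiffOn_const.clm_comp hθ).add (contDiffOn_const.clm_comp (hθ'.sub ?_))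
    exact ContinuousLinearMap.contDiff_flip.comp_contDiffOn hθ'
  · refine fun y hy ↦ (injective_iff_map_eq_zero _).2 fun v hv ↦ ?_
    have h1 := (add_zero _).symm.trans (congrArg Prod.fst hv)
    have h2 := (zero_add _).symm.trans (congrArg Prod.snd hv)
    exact hη.eq_zero_of_chartRep hy v h1 fun w ↦ sub_eq_zero.1 (DFunLike.congr_fun h2 w)
  · refine fun y hy ↦ Prod.ext ((add_zero _).trans (hη.chartRep_reebRep hy i)) ?_
    refine (zero_add _).trans ?_
    exact ContinuousLinearMap.ext fun w ↦ sub_eq_zero.2 (hη.fderiv_chartRep_reebRep hy i w)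

theorem IsKContactForm.reebRep_extChartAt {η : Form n k M} (hη : IsKContactForm η) {p q : M}
    (hq : q ∈ (chartAt (EuclideanSpace ℝ (Fin n)) p).source) (i : Fin k) :
    hη.reebRep p i (extChartAt (𝓡 n) p q) =
      mfderiv (𝓡 n) 𝓘(ℝ, EuclideanSpace ℝ (Fin n)) (extChartAt (𝓡 n) p) q (hη.reeb i q) := by
  rw [IsKContactForm.reebRep, (extChartAt (𝓡 n) p).left_inv (by simpa using hq)]

end

end KContact

/-! ### Transfer to the manifold. -/

theorem mainTheorem8 {n k : ℕ} {M : Type*} [TopologicalSpace M]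
    [ChartedSpace (EuclideanSpace ℝ (Fin n)) M] [IsManifold (𝓡 n) ∞ M]
    (η : KContact.Form n k M) (hη : KContact.IsKContactForm η) (p : M) :
    ∃ φ : OpenPartialHomeomorph M (Fin k ⊕ Fin (n - k) → ℝ),
      p ∈ φ.source ∧ KContact.IsLocalCoordinates (n := n) φ ∧
      -- the Reeb fields are the coordinate fields of the `s`-coordinates
      (∀ α : Fin k, ∀ q ∈ φ.source,
        hη.reeb α q = KContact.coordVectorField φ (Sum.inl α) q) ∧
      -- the coefficients are smooth functions of the `x`-coordinates alone
      ∃ f : Fin k → Fin (n - k) → (Fin (n - k) → ℝ) → ℝ,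
        (∀ α J, ContDiffOn ℝ ∞ (f α J) ((fun y J' ↦ y (Sum.inr J')) '' φ.target)) ∧
        ∀ α : Fin k, ∀ q ∈ φ.source,
          (ContinuousLinearMap.proj (R := ℝ) (φ := fun _ : Fin k ↦ ℝ) α).comp (η q) =
            KContact.coordOneForm φ (Sum.inl α) q -
              ∑ J : Fin (n - k), f α J (fun J' ↦ φ q (Sum.inr J')) •
                KContact.coordOneForm φ (Sum.inr J) q := by
  -- Needed for k + (n - k) = n with truncated subtraction; it holds because ker dη has rank k in an
  -- n-dimensional space.
  have hkn : k ≤ n := by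
    have : FiniteDimensional ℝ (TangentSpace (𝓡 n) p) :=
      inferInstanceAs (FiniteDimensional ℝ (EuclideanSpace ℝ (Fin n)))
    have h := Submodule.finrank_le (η.kerDAt p)
    rw [hη.rank_kerD p] at h
    exact h.trans_eq (finrank_euclideanSpace_fin (𝕜 := ℝ) (n := n))
  set c := chartAt (EuclideanSpace ℝ (Fin n)) p with hc
  obtain ⟨e, hpe, hec, hes, het, heR, f, hf, hfθ⟩ := exists_coordinates_of_reeb (κ := Fin (n - k))
    c.open_target (mem_chart_target _ p) (hη.smooth.contDiffOn_chartRep p) (hη.contDiffOn_reebRep p)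
    (fun y hy i ↦ hη.chartRep_reebRep hy i) (fun y hy i w ↦ hη.fderiv_chartRep_reebRep hy i w)
    (fun y hy i j ↦ fderiv_apply_comm_of_reeb c.open_target (hη.smooth.contDiffOn_chartRep p)
      (hη.contDiffOn_reebRep p) (fun y hy i ↦ hη.chartRep_reebRep hy i)
      (fun y hy i w ↦ hη.fderiv_chartRep_reebRep hy i w)
      (fun y hy v ↦ hη.eq_zero_of_chartRep hy v) hy i j)
    (by simp [hkn])
  have hφs : (c.trans e).source = c.source ∩ c ⁻¹' e.source := c.trans_source e
  have hφt : (c.trans e).target = e.target := by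
    rw [c.trans_target e]
    exact Set.inter_eq_left.2 fun z hz ↦ hec (e.map_target hz)
  have hcoord : KContact.IsLocalCoordinates (n := n) (c.trans e) := by
    constructor
    · rw [hφs]
      exact hes.contMDiffOn.comp (contMDiffOn_chart.mono Set.inter_subset_left) fun q hq ↦ hq.2
    · rw [hφt]
      exact contMDiffOn_chart_symm.comp het.contMDiffOn fun z hz ↦ hec (e.map_target hz)
  -- `D'` is an explicit two-sided inverse of dφ_q. It evaluates the `inverse` inside `mpullback`
  -- and lets η be computed from the components of dφ_q(v).
  have hinv (q) (hq : q ∈ (c.trans e).source) :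
      ∃ D' : (Fin k ⊕ Fin (n - k) → ℝ) →L[ℝ] TangentSpace (𝓡 n) q,
        (∀ w, D' w = mfderiv 𝓘(ℝ, EuclideanSpace ℝ (Fin n)) (𝓡 n) (extChartAt (𝓡 n) p).symm
          (extChartAt (𝓡 n) p q) (fderiv ℝ e.symm (e (c q)) w)) ∧
        (∀ w, mfderiv (𝓡 n) 𝓘(ℝ, Fin k ⊕ Fin (n - k) → ℝ) (c.trans e) q (D' w) = w) ∧
        ∀ v, D' (mfderiv (𝓡 n) 𝓘(ℝ, Fin k ⊕ Fin (n - k) → ℝ) (c.trans e) q v) = v := by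
    rw [hφs] at hq
    have : IsManifold (𝓡 n) 1 M := .of_le (n := ∞) (by simp)
    have hcq : extChartAt (𝓡 n) p q = c q := by simp [hc]
    have hd1 : DifferentiableAt ℝ e (c q) :=
      (hes.contDiffAt (e.open_source.mem_nhds hq.2)).differentiableAt (by simp)
    have hd2 : DifferentiableAt ℝ e.symm (e (c q)) :=
      (het.contDiffAt (e.open_target.mem_nhds (e.map_source hq.2))).differentiableAt (by simp)
    have hinv1 (w) : fderiv ℝ e (c q) (fderiv ℝ e.symm (e (c q)) w) = w := by
      have := e.fderiv_fderiv_symm_apply (e.map_source hq.2) (by rwa [e.left_inv hq.2]) hd2 w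
      rwa [e.left_inv hq.2] at this
    have hinv2 (w) : fderiv ℝ e.symm (e (c q)) (fderiv ℝ e (c q) w) = w :=
      e.symm.fderiv_fderiv_symm_apply hq.2 hd2 hd1 w
    have hD (v : TangentSpace (𝓡 n) q) :
        mfderiv (𝓡 n) 𝓘(ℝ, Fin k ⊕ Fin (n - k) → ℝ) (c.trans e) q v =
          fderiv ℝ e (c q)
            (mfderiv (𝓡 n) 𝓘(ℝ, EuclideanSpace ℝ (Fin n)) (extChartAt (𝓡 n) p) q v) := by
      have h := mfderiv_comp q (I := 𝓡 n) (I' := 𝓘(ℝ, EuclideanSpace ℝ (Fin n)))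
        (I'' := 𝓘(ℝ, Fin k ⊕ Fin (n - k) → ℝ)) (f := extChartAt (𝓡 n) p) (g := e)
        (by rw [hcq]; exact hd1.mdifferentiableAt) (mdifferentiableAt_extChartAt hq.1)
      rw [mfderiv_eq_fderiv] at h
      exact DFunLike.congr_fun h v
    have hmm (w : EuclideanSpace ℝ (Fin n)) :
        mfderiv (𝓡 n) 𝓘(ℝ, EuclideanSpace ℝ (Fin n)) (extChartAt (𝓡 n) p) q
          (mfderiv 𝓘(ℝ, EuclideanSpace ℝ (Fin n)) (𝓡 n) (extChartAt (𝓡 n) p).symm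
            (extChartAt (𝓡 n) p q) w) = w := by
      have h := KContact.mfderiv_extChartAt_apply (p := p) (y := extChartAt (𝓡 n) p q)
        (by rw [hcq]; exact c.map_source hq.1) w
      rwa [(extChartAt (𝓡 n) p).left_inv (by simpa using hq.1)] at h
    refine ⟨(mfderiv 𝓘(ℝ, EuclideanSpace ℝ (Fin n)) (𝓡 n) (extChartAt (𝓡 n) p).symm
      (extChartAt (𝓡 n) p q)).comp (fderiv ℝ e.symm (e (c q))), fun w ↦ rfl, fun w ↦ ?_, fun v ↦ ?_⟩
    · exact (hD _).trans ((congrArg (fderiv ℝ e (c q)) (hmm _)).trans (hinv1 w))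
    · refine Eq.trans (congrArg (mfderiv 𝓘(ℝ, EuclideanSpace ℝ (Fin n)) (𝓡 n)
        (extChartAt (𝓡 n) p).symm (extChartAt (𝓡 n) p q)) ?_)
          (KContact.mfderiv_extChartAt_symm_apply hq.1 v)
      exact (congrArg (fderiv ℝ e.symm (e (c q))) (hD v)).trans (hinv2 _)
  refine ⟨c.trans e, ?_, hcoord, fun α q hq ↦ ?_, f, ?_, fun α q hq ↦ ?_⟩
  · rw [hφs]
    exact ⟨mem_chart_source _ p, hpe⟩
  · obtain ⟨D', hD', h1, h2⟩ := hinv q hq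
    have hinverse : (mfderiv (𝓡 n) 𝓘(ℝ, Fin k ⊕ Fin (n - k) → ℝ) (c.trans e) q).inverse = D' :=
      ContinuousLinearMap.inverse_eq (ContinuousLinearMap.ext h1) (ContinuousLinearMap.ext h2)
    rw [hφs] at hq
    have hez := e.map_source hq.2
    have hRq : fderiv ℝ e.symm (e (c q)) (Pi.single (Sum.inl α) 1) =
        mfderiv (𝓡 n) 𝓘(ℝ, EuclideanSpace ℝ (Fin n)) (extChartAt (𝓡 n) p) q (hη.reeb α q) := by
      rw [heR _ hez, e.left_inv hq.2, ← hη.reebRep_extChartAt hq.1]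
      simp [hc]
    change hη.reeb α q = (mfderiv (𝓡 n) 𝓘(ℝ, Fin k ⊕ Fin (n - k) → ℝ) (c.trans e) q).inverse
      (Pi.single (Sum.inl α) (1 : ℝ) : Fin k ⊕ Fin (n - k) → ℝ)
    rw [hinverse]
    refine (KContact.mfderiv_extChartAt_symm_apply hq.1 (hη.reeb α q)).symm.trans ?_
    refine Eq.trans ?_ (hD' _).symm
    exact congrArg (mfderiv 𝓘(ℝ, EuclideanSpace ℝ (Fin n)) (𝓡 n)
        (extChartAt (𝓡 n) p).symm (extChartAt (𝓡 n) p q)) hRq.symm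
  · rwa [hφt]
  · obtain ⟨D', hD', h1, h2⟩ := hinv q hq
    have hφd : MDifferentiableAt (𝓡 n) 𝓘(ℝ, Fin k ⊕ Fin (n - k) → ℝ) (c.trans e) q :=
      (hcoord.contMDiffOn.contMDiffAt ((c.trans e).open_source.mem_nhds hq)).mdifferentiableAt
        (by simp)
    rw [hφs] at hq
    have hcf (i : Fin k ⊕ Fin (n - k)) (v : TangentSpace (𝓡 n) q) :
        KContact.coordOneForm (n := n) (c.trans e) i q v =
          (mfderiv (𝓡 n) 𝓘(ℝ, Fin k ⊕ Fin (n - k) → ℝ) (c.trans e) q v : _ → ℝ) i := by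
      have h := mfderiv_comp q (I := 𝓡 n) (I' := 𝓘(ℝ, Fin k ⊕ Fin (n - k) → ℝ)) (I'' := 𝓘(ℝ, ℝ))
        (f := c.trans e)
        (g := (ContinuousLinearMap.proj i : (Fin k ⊕ Fin (n - k) → ℝ) →L[ℝ] ℝ))
        (ContinuousLinearMap.differentiableAt _).mdifferentiableAt hφd
      rw [mfderiv_eq_fderiv, ContinuousLinearMap.fderiv] at h
      exact DFunLike.congr_fun h v
    ext v
    set w : Fin k ⊕ Fin (n - k) → ℝ :=
      mfderiv (𝓡 n) 𝓘(ℝ, Fin k ⊕ Fin (n - k) → ℝ) (c.trans e) q v with hw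
    have hηv : η q v = η.chartRep p (c q) (fderiv ℝ e.symm (e (c q)) w) := by
      have hcq : extChartAt (𝓡 n) p q = c q := by simp [hc]
      rw [← hcq]
      refine Eq.trans ?_ (η.chartRep_extChartAt_apply hq.1 _).symm
      exact congrArg (η q) ((h2 v).symm.trans ((hD' w).trans (by rw [hcq])))
    have := hfθ _ (e.map_source hq.2) w α
    rw [e.left_inv hq.2, ← hηv] at this
    refine this.trans ?_
    simp [hcf, hw]
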